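/- Let $\mathbb D=\{z\in\mathbb C:|z|<1\}$, and let $\mathcal A_0$ be the set of functions $p$ analytic in $\mathbb D$ with $p(0)=1$. For functions $f,g$ on $\mathbb D$ write $f\prec g$ ($f$ is subordinate to $g$) if there is an analytic $w:\mathbb D\to\mathbb D$ with $w(0)=0$ and $f(z)=g(w(z))$ for all $z\in\mathbb D$. Let $0<\alpha<1$, $0<B<A<1$, $k=1+\sqrt2$, $\gamma=\log\frac{e}{e-1}$ and $\wp(z)=1+ze^z$; square roots are principal. Consider the following functions $h$ and numbers $\beta_0$: 1. $h(z)=\phi_0(z)=1+\frac zk\cdot\frac{k+z}{k-z}$, $\quad\beta_0=\dfrac{-1+2k\log(1+1/k)}{\gamma k}$; 2. $h(z)=\sqrt{1+z}$, $\quad\beta_0=\dfrac{2(1-\log2)}{\gamma}$; 3. $h(z)=1+\dfrac{z}{1-\alpha z^2}$, $\quad\beta_0=\dfrac{1}{2\gamma\sqrt\alpha}\log\dfrac{1+\sqrt\alpha}{1-\sqrt\alpha}$; 4. $h(z)=\dfrac{1+Az}{1+Bz}$, $\quad\beta_0=\max\left\{\dfrac{(A-B)\log(1/(1-B))}{\gamma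 B},\ \dfrac{(A-B)\log(1+B)}{B\log(1+e)}\right\}$; 5. $h(z)=1+\sin z$, $\quad\beta_0=\dfrac1\gamma\displaystyle\sum_{n=0}^\infty\frac{(-1)^{3n+2}}{(2n+1)!\,(2n+1)}$; 6. $h(z)=z+\sqrt{1+z^2}$, $\quad\beta_0=\dfrac{3-k+\log(k/2)}{\gamma}$; 7. $h(z)=e^z$, $\quad\beta_0=\dfrac1\gamma\displaystyle\sum_{n=1}^\infty\frac{(-1)^{n+1}}{n!\,n}$. In each of the seven cases: if $\beta\ge\beta_0$ is real and $p\in\mathcal A_0$ satisfies $$1+\beta\,\frac{zp'(z)}{p(z)}\prec h(z),$$ then $p\prec\wp$. Each bound is sharp: for every $0<\beta<\beta_0$ there is a $p\in\mathcal A_0$ with $1+\beta zp'(z)/p(z)\prec h(z)$ for which $p\prec\wp$ fails. -/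

import Mathlib

open scoped Nat

noncomputable section

namespace CardioidSubordination

/-- The open unit disk. -/
def unitDisk : Set ℂ := Metric.ball 0 1

/-- Schwarz functions: analytic self-maps of the unit disk that fix the origin. -/
def IsSchwarz (w : ℂ → ℂ) : Prop :=
  DifferentiableOn ℂ w unitDisk ∧ Set.MapsTo w unitDisk unitDisk ∧ w 0 = 0

/-- Subordination `f ≺ g` on the unit disk: `f = g ∘ w` for some Schwarz function `w`. -/
def Subordinate (f g : ℂ → ℂ) : Prop :=
  ∃ w : ℂ → ℂ, IsSchwarz w ∧ ∀ z ∈ unitDisk, f z = g (w z)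

/-- The class of functions analytic in the unit disk with value `1` at the origin. -/
def ClassA0 : Set (ℂ → ℂ) :=
  {p | DifferentiableOn ℂ p unitDisk ∧ p 0 = 1}

/-- The cardioid function `℘(z) = 1 + z e^z`. -/
def cardioid (z : ℂ) : ℂ := 1 + z * Complex.exp z

/-- The expression `1 + β z p'(z) / p(z)`. Its subordination to a function that is continuous on
the disk forces `p` to have no zeros when `β ≠ 0`: near a zero of `p` the quotient is unbounded. -/
def Phi (β : ℝ) (p : ℂ → ℂ) (z : ℂ) : ℂ := 1 + (β : ℂ) * (z * deriv p z / p z)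

/-- The number `k = 1 + √2`. -/
def kConst : ℝ := 1 + √2

/-- The number `γ = log (e / (e - 1))`. -/
def gammaConst : ℝ := Real.log (Real.exp 1 / (Real.exp 1 - 1))

/-- `φ₀(z) = 1 + (z / k) ((k + z) / (k - z))`. -/
def phiZero (z : ℂ) : ℂ :=
  1 + z / (kConst : ℂ) * (((kConst : ℂ) + z) / ((kConst : ℂ) - z))

/-- `√(1 + z)`, principal branch. -/
def lemniscate (z : ℂ) : ℂ := Complex.sqrt (1 + z)

/-- `φ_α(z) = 1 + z / (1 - α z²)`. -/
def phiAlpha (α : ℝ) (z : ℂ) : ℂ := 1 + z / (1 - (α : ℂ) * z ^ 2)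

/-- `(1 + A z) / (1 + B z)`. -/
def janowski (A B : ℝ) (z : ℂ) : ℂ := (1 + (A : ℂ) * z) / (1 + (B : ℂ) * z)

/-- `1 + sin z`. -/
def sineFun (z : ℂ) : ℂ := 1 + Complex.sin z

/-- `z + √(1 + z²)`, principal branch. -/
def crescent (z : ℂ) : ℂ := z + Complex.sqrt (1 + z ^ 2)

/-- For every `p` in the class: if `1 + β z p'/p ≺ h` then `p ≺ ℘`. -/
def Implication (h : ℂ → ℂ) (β : ℝ) : Prop :=
  ∀ p ∈ ClassA0, Subordinate (Phi β p) h → Subordinate p cardioid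

/-- The implication holds for all `β ≥ β₀`, and it fails for every positive `β < β₀`. -/
def IsSharpBound (h : ℂ → ℂ) (β₀ : ℝ) : Prop :=
  (∀ β : ℝ, β₀ ≤ β → Implication h β) ∧
    ∀ β : ℝ, 0 < β → β < β₀ → ¬ Implication h β

end CardioidSubordination

end

/-! Writing p = e^P turns the hypothesis into z P' = (h(w(z)) - 1)/β with |w(z)| ≤ |z|, and the
question becomes whether e^P stays in the cardioid domain. The cusp of that domain is ℘(-1) = 1 -
1/e = e^(-γ), so the binding constraint is Re P > -γ; `exp_mem_cardioid_image` shows that it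
suffices together with the crude bound |P| ≤ 1.08.

Put g(r) = ∫₀ʳ (1 - h(-t))/t dt. At a nonzero minimum of Re P + (1 + ε) g(|z|) on a closed disk the
angular derivative vanishes, so z P' and hence h(w) are real there. Therefore Re P ≥ -g(|z|)/β needs
only that h(-r) is the least real value of h on |w| ≤ r (`neg_barrier_le_re`), and β ≥ g(1)/γ gives
Re P > -γ. The bound on |P| comes from a radial majorant of |h - 1| (`norm_le_of_norm_deriv_le`).

For sharpness take w = id: then P(-r) = -g(r)/β, and if β < g(1)/γ this equals -γ for some r < 1, so
p attains the cusp value, which ℘ omits in the disk. Each case then amounts to checking these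
hypotheses and evaluating g(1). -/

noncomputable section

namespace CardioidSubordination

/-! ### Univalence of the cardioid function and its cusp -/

/-- Injectivity criterion: a holomorphic function whose derivative has positive real part along
the open segment joining two points takes different values at them. -/
theorem ne_of_deriv_re_pos {f f' : ℂ → ℂ} {a b : ℂ} (hab : a ≠ b)
    (hf : ∀ t ∈ Set.Icc (0 : ℝ) 1, HasDerivAt f (f' (a + t * (b - a))) (a + t * (b - a)))
    (hpos : ∀ t ∈ Set.Ioo (0 : ℝ) 1, 0 < (f' (a + t * (b - a))).re) : f a ≠ f b := by
  have hba : b - a ≠ 0 := sub_ne_zero.2 hab.symm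
  have hline : ∀ t : ℝ, HasDerivAt (fun t : ℝ => a + (t : ℂ) * (b - a)) (b - a) t := fun t => by
    simpa using ((hasDerivAt_id t).ofReal_comp.mul_const (b - a)).const_add a
  have hd : ∀ t ∈ Set.Icc (0 : ℝ) 1,
      HasDerivAt (fun t : ℝ => (f (a + t * (b - a)) / (b - a)).re) (f' (a + t * (b - a))).re t := by
    intro t ht
    have h := (HasDerivAt.comp t (hf t ht) (hline t)).div_const (b - a)
    rw [mul_div_cancel_right₀ _ hba] at h
    exact (Complex.reCLM.hasFDerivAt.comp_hasDerivAt t h)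
  have hmono : StrictMonoOn (fun t : ℝ => (f (a + t * (b - a)) / (b - a)).re) (Set.Icc 0 1) := by
    apply strictMonoOn_of_deriv_pos (convex_Icc 0 1)
    · exact fun t ht => (hd t ht).continuousAt.continuousWithinAt
    · intro t ht
      rw [interior_Icc] at ht
      rw [(hd t (Set.Ioo_subset_Icc_self ht)).deriv]
      exact hpos t ht
  have := hmono (Set.left_mem_Icc.2 zero_le_one) (Set.right_mem_Icc.2 zero_le_one) zero_lt_one
  intro h
  simp [h] at this

theorem mem_unitDisk {z : ℂ} : z ∈ unitDisk ↔ ‖z‖ < 1 := by simp [unitDisk]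

theorem isOpen_unitDisk : IsOpen unitDisk := Metric.isOpen_ball

theorem exp_neg_le_quadratic {x : ℝ} (hx : 0 ≤ x) : Real.exp (-x) ≤ 1 - x + x ^ 2 / 2 := by
  rw [Real.exp_neg, inv_le_comm₀ (Real.exp_pos _) (by nlinarith [sq_nonneg (x - 1)])]
  refine le_trans ?_ (Real.quadratic_le_exp_of_nonneg hx)
  rw [inv_le_iff_one_le_mul₀ (by nlinarith)]
  -- (1 + x + x²/2)(1 - x + x²/2) = 1 + x⁴/4.
  nlinarith [sq_nonneg (x ^ 2)]

/-- With z = x + iy, cos y ≥ 1 - y²/2 > (1 + x²)/2, which is exactly the quadratic bound for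
e^(-(1+x)). The half-plane Re > 1/e is convex, which is what injectivity of ℘ needs. -/
theorem exp_neg_one_lt_re_exp {z : ℂ} (hz : z ∈ unitDisk) :
    Real.exp (-1) < (Complex.exp z).re := by
  rw [mem_unitDisk] at hz
  have hsq : z.re ^ 2 + z.im ^ 2 < 1 := by
    have := Complex.sq_norm z
    rw [Complex.normSq_apply] at this
    nlinarith [norm_nonneg z]
  have hx : -1 < z.re := by nlinarith [sq_nonneg z.im]
  have hx1 : z.re < 1 := by nlinarith [sq_nonneg z.im]
  rw [Complex.exp_re]
  have h1 : Real.exp (-1) = Real.exp z.re * Real.exp (-(1 + z.re)) := by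
    rw [← Real.exp_add]; ring_nf
  rw [h1]
  apply mul_lt_mul_of_pos_left _ (Real.exp_pos _)
  have h2 := Real.one_sub_sq_div_two_le_cos (x := z.im)
  have h3 := exp_neg_le_quadratic (x := 1 + z.re) (by linarith)
  nlinarith

theorem hasDerivAt_cardioid (z : ℂ) :
    HasDerivAt cardioid ((1 + z) * Complex.exp z) z := by
  have := ((hasDerivAt_id z).mul (Complex.hasDerivAt_exp z)).const_add 1
  refine HasDerivAt.congr_deriv (f := cardioid) this ?_
  simp; ring

theorem hasStrictDerivAt_cardioid (z : ℂ) :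
    HasStrictDerivAt cardioid ((1 + z) * Complex.exp z) z := by
  have hcd : ContDiff ℂ 1 cardioid :=
    contDiff_const.add (contDiff_id.mul Complex.contDiff_exp)
  exact hcd.contDiffAt.hasStrictDerivAt' (hasDerivAt_cardioid _) (by simp)

theorem deriv_cardioid_ne_zero {z : ℂ} (hz : z ∈ unitDisk) :
    (1 + z) * Complex.exp z ≠ 0 := by
  refine mul_ne_zero (fun h => ?_) (Complex.exp_ne_zero z)
  rw [mem_unitDisk, eq_neg_of_add_eq_zero_right h] at hz
  simp at hz

/-- In the variable u = e^z, z e^z becomes u log u, with derivative 1 + log u. Its real part 1 +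
log|u| is positive on the half-plane Re u > 1/e, which contains the segment joining two values of
exp on the disk. -/
theorem injOn_cardioid : Set.InjOn cardioid unitDisk := by
  intro z hz w hw h
  by_contra hne
  have him : ∀ v ∈ unitDisk, Complex.log (Complex.exp v) = v := by
    intro v hv
    have h1 : |v.im| < 1 := (Complex.abs_im_le_norm v).trans_lt (mem_unitDisk.1 hv)
    have h2 := Real.pi_gt_three
    rw [abs_lt] at h1
    exact Complex.log_exp (by linarith) (by linarith)
  have hexp : Complex.exp z ≠ Complex.exp w := by
    intro h'
    exact hne (by rw [← him z hz, ← him w hw, h'])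
  have hre : ∀ t ∈ Set.Icc (0 : ℝ) 1,
      Real.exp (-1) < (Complex.exp z + t * (Complex.exp w - Complex.exp z)).re := by
    intro t ht
    have h1 := exp_neg_one_lt_re_exp hz
    have h2 := exp_neg_one_lt_re_exp hw
    simp only [Complex.add_re, Complex.re_ofReal_mul, Complex.sub_re]
    rcases ht with ⟨h3, h4⟩
    rcases h3.eq_or_lt with rfl | h3
    · simpa using h1
    · nlinarith [mul_lt_mul_of_pos_left h2 h3, mul_le_mul_of_nonneg_left h1.le (sub_nonneg.2 h4)]
  refine ne_of_deriv_re_pos (f := fun u => u * Complex.log u) (f' := fun u => Complex.log u + 1)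
    hexp ?_ ?_ ?_
  · intro t ht
    have hpos := (Real.exp_pos _).trans (hre t ht)
    set u := Complex.exp z + t * (Complex.exp w - Complex.exp z)
    have hu : u ≠ 0 := fun h0 => by simp [h0] at hpos
    refine ((hasDerivAt_id u).mul (Complex.hasDerivAt_log (Or.inl hpos))).congr_deriv ?_
    simp [hu]
  · intro t ht
    have h1 := hre t (Set.Ioo_subset_Icc_self ht)
    have h2 := h1.trans_le (Complex.re_le_norm _)
    have h3 := (Real.lt_log_iff_exp_lt ((Real.exp_pos _).trans h2)).2 h2
    simp only [Complex.add_re, Complex.log_re, Complex.one_re] at h3 ⊢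
    linarith
  · simp only [him z hz, him w hw]
    simp only [cardioid] at h
    linear_combination h

/-- A function of the class with values in the cardioid domain is subordinate to `℘`. -/
theorem subordinate_cardioid {p : ℂ → ℂ} (hp : p ∈ ClassA0)
    (h : ∀ z ∈ unitDisk, p z ∈ cardioid '' unitDisk) : Subordinate p cardioid := by
  choose! w hwD hw using h
  have h0 : (0 : ℂ) ∈ unitDisk := by simp [mem_unitDisk]
  refine ⟨w, ⟨?_, fun z hz => hwD z hz, ?_⟩, fun z hz => (hw z hz).symm⟩
  · intro z hz
    refine DifferentiableAt.differentiableWithinAt ?_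
    have hpz : DifferentiableAt ℂ p z := hp.1.differentiableAt (isOpen_unitDisk.mem_nhds hz)
    have hs := hasStrictDerivAt_cardioid (w z)
    have hne := deriv_cardioid_ne_zero (hwD z hz)
    have hinv := (hs.to_localInverse hne).hasDerivAt
    set g := hs.localInverse _ _ _ hne
    have hev := HasStrictDerivAt.eventually_right_inverse hs hne
    have hgz : g (cardioid (w z)) = w z := HasStrictFDerivAt.localInverse_apply_image _
    have hgD : ∀ᶠ y in nhds (cardioid (w z)), g y ∈ unitDisk := by
      apply hinv.continuousAt.eventually_mem
      rw [hgz]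
      exact isOpen_unitDisk.mem_nhds (hwD z hz)
    rw [hw z hz] at hinv hev hgD
    -- The pointwise chosen preimage agrees with a local inverse of ℘ composed with p, by
    -- injectivity; hence it is holomorphic.
    have heq : w =ᶠ[nhds z] g ∘ p := by
      filter_upwards [hpz.continuousAt.eventually hev, hpz.continuousAt.eventually hgD,
        isOpen_unitDisk.mem_nhds hz] with y hy1 hy2 hy3
      exact injOn_cardioid (hwD y hy3) hy2 ((hw y hy3).trans hy1.symm)
    exact (hinv.differentiableAt.comp z hpz).congr_of_eventuallyEq heq
  · apply injOn_cardioid (hwD 0 h0) h0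
    rw [hw 0 h0, hp.2]
    simp [cardioid]

/-- The cusp value `1 - 1/e` is not attained in the disk. -/
theorem cusp_notMem_cardioid_image : (1 - Complex.exp (-1)) ∉ cardioid '' unitDisk := by
  rintro ⟨z, hz, h⟩
  have hz1 : -1 < z.re := by
    have := (Complex.abs_re_le_norm z).trans_lt (mem_unitDisk.1 hz)
    rw [abs_lt] at this
    exact this.1
  have h1 : z = -Complex.exp (-1 - z) := by
    simp only [cardioid] at h
    have h2 : z * Complex.exp z = -Complex.exp (-1) := by linear_combination h
    rw [sub_eq_add_neg, Complex.exp_add, ← neg_mul, ← h2, mul_assoc, ← Complex.exp_add]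
    simp
  have hre := congrArg Complex.re h1
  have him := congrArg Complex.im h1
  simp only [Complex.neg_re, Complex.neg_im, Complex.exp_re, Complex.exp_im, Complex.sub_re,
    Complex.sub_im, Complex.one_re, Complex.one_im, zero_sub, neg_zero, Real.sin_neg,
    Real.cos_neg, mul_neg, neg_neg] at hre him
  have hlt : Real.exp (-1 - z.re) < 1 := Real.exp_lt_one_iff.2 (by linarith)
  -- The imaginary part reads y = e^(-1-x) sin y with e^(-1-x) < 1, impossible for y ≠ 0; for y = 0
  -- the real part contradicts t + 1 < e^t at t = -1 - x.
  by_cases hy : z.im = 0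
  · rw [hy, Real.cos_zero] at hre
    have := Real.add_one_lt_exp (x := -1 - z.re) (by linarith)
    linarith
  · have h3 : |Real.sin z.im| < |z.im| := Real.abs_sin_lt_abs hy
    have h4 : |z.im| = Real.exp (-1 - z.re) * |Real.sin z.im| := by
      conv_lhs => rw [him]
      rw [abs_mul, abs_of_pos (Real.exp_pos _)]
    nlinarith [abs_nonneg (Real.sin z.im), Real.exp_pos (-1 - z.re)]

/-! ### The exponential of a truncated disk lies in the cardioid domain -/

theorem quartic_le_exp {s : ℝ} (hs : 0 ≤ s) :
    1 + s + s ^ 2 / 2 + s ^ 3 / 6 + s ^ 4 / 24 ≤ Real.exp s := by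
  refine le_trans (le_of_eq ?_) (Real.sum_le_exp_of_nonneg hs 5)
  simp [Finset.sum_range_succ, Nat.factorial]

/-- Obtained by squaring 1 - (y/2)²/2 ≤ cos (y/2) in the double-angle formula; y ≤ 2 keeps the left
side nonnegative. -/
theorem quartic_le_cos {y : ℝ} (hy0 : 0 ≤ y) (hy : y ≤ 2) :
    1 - y ^ 2 / 2 + y ^ 4 / 32 ≤ Real.cos y := by
  have h1 := Real.one_sub_sq_div_two_le_cos (x := y / 2)
  have h2 := Real.cos_two_mul (y / 2)
  rw [mul_div_cancel₀ y (two_ne_zero)] at h2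
  have h3 : 0 ≤ 1 - (y / 2) ^ 2 / 2 := by nlinarith
  have h4 := pow_le_pow_left₀ h3 h1 2
  nlinarith

theorem norm_exp_sub_one_le_exp_norm (u : ℂ) :
    ‖Complex.exp u - 1‖ ≤ Real.exp ‖u‖ - 1 := by
  simpa using Complex.norm_exp_sub_sum_le_exp_norm_sub_sum u 1

/-- The exponential factor is bounded below at the left endpoint, the cosine factor at the right
one, so a numerical check at a and b covers the whole interval. -/
theorem exp_sin_mul_cos_gt_of_mem {a b x : ℝ} (ha : 0 ≤ a) (hax : a ≤ x) (hxb : x ≤ b)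
    (hb : b ≤ 3 / 4)
    (h : 0.8826 < (1 + (a - a ^ 3 / 6) + (a - a ^ 3 / 6) ^ 2 / 2 + (a - a ^ 3 / 6) ^ 3 / 6
      + (a - a ^ 3 / 6) ^ 4 / 24) *
      (1 - (b + 0.08 + b ^ 2 / 2) ^ 2 / 2 + (b + 0.08 + b ^ 2 / 2) ^ 4 / 32)) :
    0.8826 < Real.exp (Real.sin x) * Real.cos (x + 1.08 - Real.cos x) := by
  have hpi := Real.pi_gt_three
  have hs0 : 0 ≤ a - a ^ 3 / 6 := by
    have : a ^ 2 ≤ 1 := by nlinarith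
    nlinarith
  have h1 : a - a ^ 3 / 6 ≤ Real.sin x :=
    (Real.sin_ge_sub_cube ha).trans
      (Real.sin_le_sin_of_le_of_le_pi_div_two (by linarith) (by linarith) hax)
  have h2 := (quartic_le_exp hs0).trans (Real.exp_le_exp.2 h1)
  have hx0 : 0 ≤ x := ha.trans hax
  have h3 := Real.one_sub_sq_div_two_le_cos (x := x)
  have h4 := Real.cos_le_one x
  have h5 : x + 1.08 - Real.cos x ≤ b + 0.08 + b ^ 2 / 2 := by nlinarith
  have hb2 : b + 0.08 + b ^ 2 / 2 ≤ 1.2 := by nlinarith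
  have h6 : Real.cos (b + 0.08 + b ^ 2 / 2) ≤ Real.cos (x + 1.08 - Real.cos x) :=
    Real.cos_le_cos_of_nonneg_of_le_pi (by linarith) (by linarith) h5
  have h7 := (quartic_le_cos (y := b + 0.08 + b ^ 2 / 2) (by nlinarith) (by linarith)).trans h6
  refine h.trans_le (mul_le_mul h2 h7 ?_ (Real.exp_pos _).le)
  nlinarith [sq_nonneg ((b + 0.08 + b ^ 2 / 2) ^ 2)]

/-- As 0.8826 > sin 1.08, this puts the boundary points ℘(sin x + i cos x) strictly above the line
through 0 at angle 1.08. -/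
theorem exp_sin_mul_cos_gt {x : ℝ} (hx0 : -0.1 ≤ x) (hx1 : x ≤ 0.731) :
    0.8826 < Real.exp (Real.sin x) * Real.cos (x + 1.08 - Real.cos x) := by
  rcases le_total x 0 with h | h
  · have h1 : x ≤ Real.sin x := Real.le_sin h
    have h2 : 0.9 ≤ Real.exp (Real.sin x) := by
      have := Real.add_one_le_exp (Real.sin x)
      linarith
    have h3 := Real.one_sub_sq_div_two_le_cos (x := x)
    have h4 := Real.cos_le_one x
    have h5 := Real.one_sub_sq_div_two_le_cos (x := x + 1.08 - Real.cos x)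
    have h6 : x + 1.08 - Real.cos x ≤ 0.1 := by nlinarith
    have h7 : -0.1 ≤ x + 1.08 - Real.cos x := by nlinarith
    have h8 : 0.99 ≤ Real.cos (x + 1.08 - Real.cos x) := by nlinarith
    nlinarith
  -- The cells are short enough for the endpoint estimate to clear 0.8826 on each.
  rcases le_total x 0.1 with h' | h'
  · exact exp_sin_mul_cos_gt_of_mem le_rfl h h' (by norm_num) (by norm_num)
  rcases le_total x 0.45 with h | h
  · exact exp_sin_mul_cos_gt_of_mem (by norm_num) h' h (by norm_num) (by norm_num)
  rcases le_total x 0.6 with h' | h'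
  · exact exp_sin_mul_cos_gt_of_mem (by norm_num) h h' (by norm_num) (by norm_num)
  rcases le_total x 0.7 with h | h
  · exact exp_sin_mul_cos_gt_of_mem (by norm_num) h' h (by norm_num) (by norm_num)
  rcases le_total x 0.72 with h' | h'
  · exact exp_sin_mul_cos_gt_of_mem (by norm_num) h h' (by norm_num) (by norm_num)
  · exact exp_sin_mul_cos_gt_of_mem (by norm_num) h' hx1 (by norm_num) (by norm_num)

theorem sin_108_lt : Real.sin 1.08 < 0.8826 := by
  have h1 : Real.sin 1.08 = Real.cos (Real.pi / 2 - 1.08) := (Real.cos_pi_div_two_sub _).symm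
  have h2 := Real.pi_gt_d4
  have h3 := Real.pi_lt_d4
  rw [h1]
  have h4 : Real.cos (Real.pi / 2 - 1.08) ≤ Real.cos 0.49 :=
    Real.cos_le_cos_of_nonneg_of_le_pi (by norm_num) (by linarith) (by linarith)
  have h5 := Real.cos_bound (x := 0.49) (by rw [abs_of_pos] <;> norm_num)
  rw [abs_of_pos (show (0 : ℝ) < 0.49 by norm_num)] at h5
  have h6 := (abs_le.1 h5).2
  -- The Taylor error at 0.49 is too coarse for 0.8826; halving the angle makes it small enough.
  have h7 : Real.cos 0.49 = 2 * Real.cos 0.245 ^ 2 - 1 := by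
    rw [← Real.cos_two_mul]; norm_num
  have h8 := Real.cos_bound (x := 0.245) (by rw [abs_of_pos] <;> norm_num)
  rw [abs_of_pos (show (0 : ℝ) < 0.245 by norm_num)] at h8
  have h9 := (abs_le.1 h8).2
  have h10 : 0 ≤ Real.cos 0.245 := Real.cos_nonneg_of_mem_Icc ⟨by linarith, by linarith⟩
  have h11 : Real.cos 0.245 ≤ 0.97018 := by norm_num at h9 ⊢; linarith
  nlinarith

/-- The left side is |℘(ζ)|² for ζ on the unit circle at angle ψ from -1, so the arc near the cusp
lies in the disk of radius 1 - 1/e. With m = 1/e, E = e^(-cos ψ) and t = 1 - cos ψ, the gain (E -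
m)(2 - E - m) ≥ m(1 - m)(t + t²/2) is of order ψ² and beats the loss (ψ - sin ψ)² ≤ ψ⁶/36. -/
theorem modulus_bound {ψ : ℝ} (h0 : 0 ≤ ψ) (h1 : ψ ≤ 1.471) :
    (1 - Real.exp (-Real.cos ψ)) ^ 2
      + 2 * Real.exp (-Real.cos ψ) * (1 - Real.cos (ψ - Real.sin ψ))
      ≤ (1 - Real.exp (-1)) ^ 2 := by
  have hpi := Real.pi_gt_d4
  have hcos : 0 ≤ Real.cos ψ := Real.cos_nonneg_of_mem_Icc ⟨by linarith, by linarith⟩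
  set t := 1 - Real.cos ψ with ht
  have hE : Real.exp (-Real.cos ψ) = Real.exp (-1) * Real.exp t := by
    rw [← Real.exp_add, ht]; ring_nf
  have hE1 : Real.exp (-Real.cos ψ) ≤ 1 := Real.exp_le_one_iff.2 (by linarith)
  have hE0 := Real.exp_pos (-Real.cos ψ)
  have ht0 : 0 ≤ t := by linarith [Real.cos_le_one ψ]
  have he := Real.quadratic_le_exp_of_nonneg ht0
  have hδ := Real.one_sub_sq_div_two_le_cos (x := ψ - Real.sin ψ)
  have hδ0 : 0 ≤ ψ - Real.sin ψ := by linarith [Real.sin_le h0]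
  have hδ1 : ψ - Real.sin ψ ≤ ψ ^ 3 / 6 := by linarith [Real.sin_ge_sub_cube h0]
  have hδ2 := pow_le_pow_left₀ hδ0 hδ1 2
  have hg := Real.exp_neg_one_gt_d9
  have hl := Real.exp_neg_one_lt_d9
  set E := Real.exp (-Real.cos ψ)
  set m := Real.exp (-1)
  have hq0 : 0 ≤ ψ ^ 2 := sq_nonneg ψ
  -- 1.471² < 2.164; below, 0.2325 is a lower value for m(1 - m).
  have hq1 : ψ ^ 2 ≤ 2.164 := by nlinarith
  have hts : ψ ^ 2 * 0.4098 ≤ t := by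
    have h2 : 1 - Real.cos ψ = 2 * Real.sin (ψ / 2) ^ 2 := by
      have h3 := Real.cos_two_mul (ψ / 2)
      rw [mul_div_cancel₀ ψ (two_ne_zero)] at h3
      have h4 := Real.sin_sq_add_cos_sq (ψ / 2)
      linarith
    have h3 := Real.sin_ge_sub_cube (x := ψ / 2) (by linarith)
    have h5 : 0 ≤ ψ / 2 - (ψ / 2) ^ 3 / 6 := by nlinarith
    have h4 := pow_le_pow_left₀ h5 h3 2
    rw [ht, h2]
    nlinarith [pow_nonneg h0 6, mul_nonneg hq0 (sub_nonneg.2 hq1)]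
  have hkey : (ψ ^ 3 / 6) ^ 2 ≤ 0.2325 * (t + t ^ 2 / 2) := by
    have h3 : (ψ ^ 2 * 0.4098) ^ 2 ≤ t ^ 2 := pow_le_pow_left₀ (by positivity) hts 2
    have h4 : (ψ ^ 2) ^ 2 * ψ ^ 2 ≤ 2.164 * (ψ ^ 2) * ψ ^ 2 := by
      have := mul_nonneg (mul_nonneg hq0 hq0) (sub_nonneg.2 hq1)
      nlinarith
    nlinarith [mul_nonneg hq0 (sub_nonneg.2 hq1)]
  have h5 : 2 * E * (1 - Real.cos (ψ - Real.sin ψ)) ≤ (ψ ^ 3 / 6) ^ 2 := by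
    have h6 : 0 ≤ 1 - Real.cos (ψ - Real.sin ψ) := by linarith [Real.cos_le_one (ψ - Real.sin ψ)]
    nlinarith
  have h7 : m * (t + t ^ 2 / 2) ≤ E - m := by
    rw [hE]; nlinarith
  have h8 : m * (t + t ^ 2 / 2) * (1 - m) ≤ (E - m) * (2 - E - m) :=
    mul_le_mul h7 (by linarith) (by linarith) ((by positivity : (0 : ℝ) ≤ _).trans h7)
  have h9 : 0.2325 ≤ m * (1 - m) := by nlinarith
  have h10 : 0.2325 * (t + t ^ 2 / 2) ≤ m * (1 - m) * (t + t ^ 2 / 2) :=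
    mul_le_mul_of_nonneg_right h9 (by positivity)
  nlinarith

theorem exp_neg_gammaConst : Real.exp (-gammaConst) = 1 - Real.exp (-1) := by
  have h1 : 1 < Real.exp 1 := Real.one_lt_exp_iff.2 one_pos
  rw [gammaConst, ← Real.log_inv, Real.exp_log (by rw [inv_div]; apply div_pos <;> linarith),
    inv_div, sub_div, div_self (by linarith), Real.exp_neg, one_div]

theorem gammaConst_pos : 0 < gammaConst := by
  have h1 := exp_neg_gammaConst
  have h2 : Real.exp (-gammaConst) < 1 := by rw [h1]; linarith [Real.exp_pos (-1)]
  linarith [Real.exp_lt_one_iff.1 h2]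

/-- The upper boundary splits into three arcs, each with its own obstruction: for x > 0.731 the
distance to 1 exceeds e^1.08 - 1; in the middle the arc lies above the ray of angle 1.08 ≥ |Im u|;
near the cusp its modulus is at most 1 - 1/e < |e^u|. -/
theorem exp_ne_cardioid_aux {u : ℂ} (hu : ‖u‖ ≤ 1.08) (hre : -gammaConst < u.re) {x : ℝ}
    (hx0 : -(Real.pi / 2) ≤ x) (hx1 : x ≤ Real.pi / 2) :
    Complex.exp u ≠ cardioid ⟨Real.sin x, Real.cos x⟩ := by
  have hpi := Real.pi_gt_d4
  have hpi' := Real.pi_lt_d4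
  intro h
  have hprod : (⟨Real.sin x, Real.cos x⟩ : ℂ) * Complex.exp ⟨Real.sin x, Real.cos x⟩
      = ⟨Real.exp (Real.sin x) * Real.sin (x - Real.cos x),
        Real.exp (Real.sin x) * Real.cos (x - Real.cos x)⟩ := by
    apply Complex.ext
    · simp only [Complex.mul_re, Complex.exp_re, Complex.exp_im, Real.sin_sub]; ring
    · simp only [Complex.mul_im, Complex.exp_re, Complex.exp_im, Real.cos_sub]; ring
  rw [cardioid, hprod] at h
  rcases lt_or_ge 0.731 x with hx | hx
  · have h1 : ‖Complex.exp u - 1‖ = Real.exp (Real.sin x) := by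
      rw [h, add_sub_cancel_left, ← sq_eq_sq₀ (norm_nonneg _) (Real.exp_pos _).le,
        Complex.sq_norm, Complex.normSq_mk]
      linear_combination Real.exp (Real.sin x) ^ 2 * Real.sin_sq_add_cos_sq (x - Real.cos x)
    have h2 : ‖Complex.exp u - 1‖ ≤ Real.exp 1.08 - 1 :=
      (norm_exp_sub_one_le_exp_norm u).trans
        (sub_le_sub_right (Real.exp_le_exp.2 hu) 1)
    have h3 : Real.exp 1.08 < 2.9447 := by
      have h4 : Real.exp 1.08 = Real.exp 1 * Real.exp 0.08 := by rw [← Real.exp_add]; norm_num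
      have h5 := Real.exp_bound' (x := 0.08) (by norm_num) (by norm_num) (n := 4) (by norm_num)
      have h6 := Real.exp_one_lt_d9
      have h7 : Real.exp 0.08 ≤ 1.08329 := h5.trans (by
        norm_num [Finset.sum_range_succ, Nat.factorial])
      rw [h4]
      nlinarith [Real.exp_pos 0.08]
    have h4 : 0.6658 ≤ Real.sin x := by
      have h5 := Real.sin_ge_sub_cube (x := 0.731) (by norm_num)
      have h6 := Real.sin_le_sin_of_le_of_le_pi_div_two (by linarith) hx1 hx.le
      norm_num at h5 ⊢
      linarith
    have h5 := (quartic_le_exp (s := 0.6658) (by norm_num)).trans (Real.exp_le_exp.2 h4)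
    norm_num at h5
    linarith
  rcases le_or_gt (-0.1) x with hx' | hx'
  · have h1 := exp_sin_mul_cos_gt hx' hx
    have h2 := sin_108_lt
    have hi := congrArg Complex.im h
    have hr := congrArg Complex.re h
    simp only [Complex.exp_re, Complex.exp_im, Complex.add_re, Complex.add_im, Complex.one_re,
      Complex.one_im] at hi hr
    have hb := abs_le.1 ((Complex.abs_im_le_norm u).trans hu)
    have h3 : Real.sin (1.08 - u.im) ≥ 0 :=
      Real.sin_nonneg_of_nonneg_of_le_pi (by linarith) (by linarith)
    have h4 := mul_nonneg (Real.exp_pos u.re).le h3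
    -- Both sides evaluate the functional sin 1.08 · Re - cos 1.08 · Im, at e^u and at the boundary
    -- point.
    have h5 : Real.exp u.re * Real.sin (1.08 - u.im) = Real.sin 1.08
        - Real.exp (Real.sin x) * Real.cos (x + 1.08 - Real.cos x) := by
      rw [show x + 1.08 - Real.cos x = 1.08 + (x - Real.cos x) by ring, Real.cos_add,
        Real.sin_sub]
      linear_combination Real.sin 1.08 * hr - Real.cos 1.08 * hi
    linarith
  · have h1 := modulus_bound (ψ := Real.pi / 2 + x) (by linarith) (by linarith)
    have h2 : Real.cos (Real.pi / 2 + x) = -Real.sin x := by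
      rw [add_comm, Real.cos_add_pi_div_two]
    have h3 : Real.sin (Real.pi / 2 + x) = Real.cos x := by
      rw [add_comm, Real.sin_add_pi_div_two]
    have h4 : Real.cos (Real.pi / 2 + x - Real.cos x) = -Real.sin (x - Real.cos x) := by
      rw [show Real.pi / 2 + x - Real.cos x = (x - Real.cos x) + Real.pi / 2 by ring,
        Real.cos_add_pi_div_two]
    rw [h2, h3, h4, neg_neg] at h1
    have h5 : 1 - Real.exp (-1) < ‖Complex.exp u‖ := by
      rw [Complex.norm_exp, ← exp_neg_gammaConst]
      exact Real.exp_lt_exp.2 hre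
    have h6 : 0 < 1 - Real.exp (-1) := by rw [← exp_neg_gammaConst]; exact Real.exp_pos _
    have h7 := pow_lt_pow_left₀ h5 h6.le two_ne_zero
    rw [h, Complex.sq_norm, Complex.normSq_apply] at h7
    simp only [Complex.add_re, Complex.add_im, Complex.one_re, Complex.one_im] at h7
    have h8 := Real.sin_sq_add_cos_sq (x - Real.cos x)
    have h9 : Real.exp (Real.sin x) ^ 2 * (Real.sin (x - Real.cos x) ^ 2
        + Real.cos (x - Real.cos x) ^ 2) = Real.exp (Real.sin x) ^ 2 := by rw [h8, mul_one]
    linarith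

theorem exp_ne_cardioid {u ζ : ℂ} (hu : ‖u‖ ≤ 1.08) (hre : -gammaConst < u.re) (hζ : ‖ζ‖ = 1) :
    Complex.exp u ≠ cardioid ζ := by
  wlog him : 0 ≤ ζ.im generalizing u ζ
  · intro h
    refine this (u := starRingEnd ℂ u) (ζ := starRingEnd ℂ ζ) (by simpa using hu)
      (by simpa using hre) (by simpa using hζ) (by simp; linarith) ?_
    rw [Complex.exp_conj, h]
    simp [cardioid, Complex.exp_conj]
  have hsq : ζ.re ^ 2 + ζ.im ^ 2 = 1 := by
    have := Complex.sq_norm ζ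
    rw [Complex.normSq_apply, hζ] at this
    linarith
  have h1 : -1 ≤ ζ.re := by nlinarith [sq_nonneg ζ.im]
  have h2 : ζ.re ≤ 1 := by nlinarith [sq_nonneg ζ.im]
  have h3 : ζ = ⟨Real.sin (Real.arcsin ζ.re), Real.cos (Real.arcsin ζ.re)⟩ := by
    rw [Real.sin_arcsin h1 h2, Real.cos_arcsin, ← hsq, add_sub_cancel_left, Real.sqrt_sq him]
  rw [h3]
  exact exp_ne_cardioid_aux hu hre (Real.neg_pi_div_two_le_arcsin _) (Real.arcsin_le_pi_div_two _)

/-- The exponential maps `{‖u‖ ≤ 1.08, Re u > -γ}` into the cardioid domain. -/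
theorem exp_mem_cardioid_image {u : ℂ} (hu : ‖u‖ ≤ 1.08) (hre : -gammaConst < u.re) :
    Complex.exp u ∈ cardioid '' unitDisk := by
  set R : Set ℂ := Metric.closedBall 0 1.08 ∩ {u | -gammaConst < u.re}
  have hγ := gammaConst_pos
  have hconv : Convex ℝ R :=
    (convex_closedBall _ _).inter (convex_halfSpace_re_gt _)
  have hpre : IsPreconnected (Complex.exp '' R) :=
    hconv.isPreconnected.image _ Complex.continuous_exp.continuousOn
  have hcont : Continuous cardioid := by unfold cardioid; fun_prop
  have hopen : IsOpen (cardioid '' unitDisk) := by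
    rw [isOpen_iff_mem_nhds]
    rintro _ ⟨z, hz, rfl⟩
    rw [← (hasStrictDerivAt_cardioid z).map_nhds_eq (deriv_cardioid_ne_zero hz)]
    exact Filter.image_mem_map (isOpen_unitDisk.mem_nhds hz)
  have hclosed : IsClosed (cardioid '' Metric.closedBall 0 1) :=
    ((isCompact_closedBall _ _).image hcont).isClosed
  have hsub : Complex.exp '' R ⊆ cardioid '' unitDisk := by
    -- The connected set exp(R) contains 1 = ℘(0) and misses the image of the unit circle, so it
    -- cannot leave the open image of the disk for the complement of the compact image of the closed
    -- disk.
    refine hpre.subset_left_of_subset_union hopen hclosed.isOpen_compl ?_ ?_ ?_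
    · rw [Set.disjoint_compl_right_iff_subset]
      exact Set.image_mono Metric.ball_subset_closedBall
    · rintro _ ⟨v, ⟨hv1, hv2⟩, rfl⟩
      by_cases hv : Complex.exp v ∈ cardioid '' Metric.closedBall 0 1
      · obtain ⟨ζ, hζ, he⟩ := hv
        refine Or.inl ⟨ζ, ?_, he⟩
        rw [mem_closedBall_zero_iff] at hζ hv1
        rw [mem_unitDisk]
        refine lt_of_le_of_ne hζ fun h1 => ?_
        exact exp_ne_cardioid hv1 hv2 h1 he.symm
      · exact Or.inr hv
    · refine ⟨1, ⟨0, ⟨by simp; norm_num, by simpa using hγ⟩, by simp⟩,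
        ⟨0, by simp [mem_unitDisk], by simp [cardioid]⟩⟩
  exact hsub ⟨u, ⟨by simpa using hu, hre⟩, rfl⟩

/-! ### The logarithm of p and its growth bounds -/

/-- A holomorphic function vanishing at `0` is `z G'(z)` for some holomorphic `G`. -/
theorem exists_logarithmic_primitive {f : ℂ → ℂ} (hf : DifferentiableOn ℂ f unitDisk)
    (h0 : f 0 = 0) :
    ∃ G K : ℂ → ℂ, G 0 = 0 ∧ DifferentiableOn ℂ K unitDisk ∧
      ∀ z ∈ unitDisk, HasDerivAt G (K z) z ∧ z * K z = f z := by
  have hK : DifferentiableOn ℂ (dslope f 0) unitDisk :=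
    (Complex.differentiableOn_dslope (isOpen_unitDisk.mem_nhds (by simp [mem_unitDisk]))).2 hf
  obtain ⟨G, hG0, hG⟩ := (DifferentiableOn.isExactOn_ball hK).with_val_at 0 0
  refine ⟨G, _, hG0, hK, fun z hz => ⟨hG z hz, ?_⟩⟩
  simpa [h0] using sub_smul_dslope f 0 z

theorem exists_log_of_subordinate {h p : ℂ → ℂ} {β : ℝ} (hβ : 0 < β)
    (hh : DifferentiableOn ℂ h unitDisk) (h0 : h 0 = 1) (hp : p ∈ ClassA0)
    (hs : Subordinate (Phi β p) h) :
    ∃ w P K : ℂ → ℂ, IsSchwarz w ∧ P 0 = 0 ∧ ∀ z ∈ unitDisk,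
      HasDerivAt P (K z) z ∧ z * K z = (h (w z) - 1) / β ∧ p z = Complex.exp (P z) := by
  obtain ⟨w, hw, hPhi⟩ := hs
  have hβ' : (β : ℂ) ≠ 0 := by exact_mod_cast hβ.ne'
  have hmem0 : (0 : ℂ) ∈ unitDisk := by simp [mem_unitDisk]
  obtain ⟨P, K, hP0, hK, hPK⟩ :=
    exists_logarithmic_primitive (f := fun z => (h (w z) - 1) / β)
      (((hh.comp hw.1 hw.2.1).sub_const 1).div_const _) (by simp [hw.2.2, h0])
  refine ⟨w, P, K, hw, hP0, fun z hz => ⟨(hPK z hz).1, (hPK z hz).2, ?_⟩⟩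
  have hconn : IsPreconnected unitDisk := (convex_ball _ _).isPreconnected
  have hpd : ∀ z ∈ unitDisk, HasDerivAt p (deriv p z) z := fun z hz =>
    (hp.1.differentiableAt (isOpen_unitDisk.mem_nhds hz)).hasDerivAt
  have hode : Set.EqOn (deriv p) (fun z => p z * K z) unitDisk := by
    -- The quotient p'/p is meaningful only where p ≠ 0, which is known near 0; the identity theorem
    -- extends p' = pK to the disk, and then p e^(-P) is constant, so p has no zeros.
    refine AnalyticOnNhd.eqOn_of_preconnected_of_frequently_eq
      ((hp.1.deriv isOpen_unitDisk).analyticOnNhd isOpen_unitDisk)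
      ((hp.1.mul hK).analyticOnNhd isOpen_unitDisk) hconn hmem0 ?_
    apply Filter.Eventually.frequently
    have hne : ∀ᶠ z in nhds (0 : ℂ), p z ≠ 0 :=
      (hpd 0 hmem0).continuousAt.eventually_ne (by rw [hp.2]; exact one_ne_zero)
    filter_upwards [nhdsWithin_le_nhds hne, self_mem_nhdsWithin,
      nhdsWithin_le_nhds (isOpen_unitDisk.mem_nhds hmem0)] with z hz1 hz2 hz3
    have h1 := hPhi z hz3
    have h2 := (hPK z hz3).2
    rw [← h1, Phi] at h2
    have hz2' : z ≠ 0 := hz2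
    field_simp at h2
    apply mul_left_cancel₀ (mul_ne_zero hz2' hβ')
    linear_combination -h2
  have hder : ∀ z ∈ unitDisk, HasDerivAt (fun z => p z * Complex.exp (-P z)) 0 z := by
    intro z hz
    refine ((hpd z hz).mul ((hPK z hz).1.neg.cexp)).congr_deriv ?_
    rw [hode hz]
    ring
  have hconst := isOpen_unitDisk.is_const_of_deriv_eq_zero hconn
    (fun z hz => (hder z hz).differentiableAt.differentiableWithinAt)
    (fun z hz => (hder z hz).deriv) hz hmem0
  simp only [hP0, hp.2, neg_zero, Complex.exp_zero, mul_one] at hconst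
  rw [Complex.exp_neg] at hconst
  field_simp [Complex.exp_ne_zero] at hconst
  exact hconst

/-- Lower barrier for the real part, obtained by minimizing `Re P(z) + (1 + ε) g(|z|)`. -/
theorem neg_barrier_le_re {P K : ℂ → ℂ} {g d : ℝ → ℝ}
    (hP : ∀ z ∈ unitDisk, HasDerivAt P (K z) z) (hP0 : P 0 = 0)
    (hg : ∀ r ∈ Set.Ioo (0 : ℝ) 1, HasDerivAt g (d r) r) (hgc : ContinuousOn g (Set.Ico 0 1))
    (hg0 : g 0 = 0) (hd : ∀ r ∈ Set.Ioo (0 : ℝ) 1, 0 < d r)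
    (hB : ∀ z ∈ unitDisk, z ≠ 0 → (z * K z).im = 0 → -(‖z‖ * d ‖z‖) ≤ (z * K z).re)
    {z : ℂ} (hz : z ∈ unitDisk) : -g ‖z‖ ≤ (P z).re := by
  have main : ∀ ε : ℝ, 0 < ε → 0 ≤ (P z).re + (1 + ε) * g ‖z‖ := by
    intro ε hε
    have hz1 := mem_unitDisk.1 hz
    have hmem : ∀ y ∈ Metric.closedBall (0 : ℂ) ‖z‖, y ∈ unitDisk := fun y hy =>
      mem_unitDisk.2 ((mem_closedBall_zero_iff.1 hy).trans_lt hz1)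
    have hcont : ContinuousOn (fun y => (P y).re + (1 + ε) * g ‖y‖)
        (Metric.closedBall 0 ‖z‖) := by
      refine ContinuousOn.add ?_ (ContinuousOn.mul continuousOn_const ?_)
      · exact Complex.continuous_re.comp_continuousOn fun y hy =>
          (hP y (hmem y hy)).continuousAt.continuousWithinAt
      · exact hgc.comp continuous_norm.continuousOn fun y hy =>
          ⟨norm_nonneg y, mem_unitDisk.1 (hmem y hy)⟩
    obtain ⟨v, hv, hmin⟩ := (isCompact_closedBall (0 : ℂ) ‖z‖).exists_isMinOn
      ⟨z, by simp⟩ hcont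
    have hle := isMinOn_iff.1 hmin
    have hvD := hmem v hv
    by_cases hv0 : v = 0
    · have := hle z (by simp)
      simpa [hv0, hP0, hg0] using this
    exfalso
    have hvn : 0 < ‖v‖ := norm_pos_iff.2 hv0
    have hv1 := mem_unitDisk.1 hvD
    have hPv := hP v hvD
    -- Rotation fixes |v|, so Re P alone is minimal along the circle; its angular derivative is
    -- -Im(v K(v)).
    have hang : (v * K v).im = 0 := by
      have h1 : HasDerivAt (fun t : ℝ => v * Complex.exp (t * Complex.I)) (v * Complex.I) 0 := by
        have := (((hasDerivAt_id (0 : ℝ)).ofReal_comp.mul_const Complex.I).cexp).const_mul v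
        simpa using this
      have h2 : HasDerivAt (fun t : ℝ => P (v * Complex.exp (t * Complex.I)))
          (K v * (v * Complex.I)) 0 :=
        HasDerivAt.comp (h₂ := P) (0 : ℝ) (by simpa using hPv) h1
      have h3 := Complex.reCLM.hasFDerivAt.comp_hasDerivAt (0 : ℝ) h2
      have h4 : IsLocalMin (fun t : ℝ => (P (v * Complex.exp (t * Complex.I))).re) 0 := by
        refine Filter.Eventually.of_forall fun t => ?_
        have hn : ‖v * Complex.exp (t * Complex.I)‖ = ‖v‖ := by
          rw [norm_mul, Complex.norm_exp_ofReal_mul_I, mul_one]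
        have := hle (v * Complex.exp (t * Complex.I))
          (by rw [mem_closedBall_zero_iff, hn]; exact mem_closedBall_zero_iff.1 hv)
        rw [hn] at this
        simpa using this
      have h5 := h4.hasDerivAt_eq_zero h3
      simp only [Complex.reCLM_apply, Complex.mul_re, Complex.mul_im, Complex.I_re,
        Complex.I_im] at h5 ⊢
      linarith
    have hrad : (v * K v).re + (1 + ε) * (‖v‖ * d ‖v‖) ≤ 0 := by
      have h1 : HasDerivAt (fun s : ℝ => (s : ℂ) * v) v 1 := by
        simpa using (hasDerivAt_id (1 : ℝ)).ofReal_comp.mul_const v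
      have h2 : HasDerivAt (fun s : ℝ => P ((s : ℂ) * v)) (K v * v) 1 :=
        HasDerivAt.comp (h₂ := P) (1 : ℝ) (by simpa using hPv) h1
      have h3 := Complex.reCLM.hasFDerivAt.comp_hasDerivAt (1 : ℝ) h2
      have h4 : HasDerivAt (fun s : ℝ => g (s * ‖v‖)) (d ‖v‖ * ‖v‖) 1 :=
        HasDerivAt.comp (h₂ := g) (1 : ℝ) (by simpa using hg ‖v‖ ⟨hvn, hv1⟩)
          (by simpa using (hasDerivAt_id (1 : ℝ)).mul_const ‖v‖)
      have h5 := (h3.add (h4.const_mul (1 + ε))).hasDerivWithinAt (s := Set.Iio 1)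
      -- Only slopes from the left are available, since v may lie on the boundary of the closed
      -- ball.
      rw [hasDerivWithinAt_iff_tendsto_slope' (by simp)] at h5
      have h6 := le_of_tendsto h5 (b := 0) (by
        filter_upwards [self_mem_nhdsWithin,
          nhdsWithin_le_nhds (Ioi_mem_nhds (zero_lt_one (α := ℝ)))] with s hs1 hs0
        rw [Set.mem_Iio] at hs1
        rw [Set.mem_Ioi] at hs0
        have hn : ‖(s : ℂ) * v‖ = s * ‖v‖ := by
          rw [norm_mul, Complex.norm_real, Real.norm_of_nonneg hs0.le]
        have := hle ((s : ℂ) * v) (by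
          rw [mem_closedBall_zero_iff, hn]
          have := mem_closedBall_zero_iff.1 hv
          nlinarith)
        rw [hn] at this
        rw [slope_def_field]
        apply div_nonpos_of_nonneg_of_nonpos
        · simpa using this
        · linarith)
      have h7 : Complex.reCLM (K v * v) = (v * K v).re := by rw [mul_comm]; rfl
      rw [h7] at h6
      linarith
    have h1 := hB v hvD hv0 hang
    have h2 := mul_pos hε (mul_pos hvn (hd ‖v‖ ⟨hvn, hv1⟩))
    linarith
  by_contra hlt
  push Not at hlt
  rcases le_or_gt (g ‖z‖) 0 with hg' | hg'
  · have := main 1 one_pos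
    linarith
  -- This ε makes Re P + (1 + ε) g equal to (Re P + g)/2, which is negative.
  · have h1 := main ((-(P z).re - g ‖z‖) / (2 * g ‖z‖)) (div_pos (by linarith) (by linarith))
    have h2 : (-(P z).re - g ‖z‖) / (2 * g ‖z‖) * g ‖z‖ = (-(P z).re - g ‖z‖) / 2 := by
      field_simp
    nlinarith

/-- Pairing P along the ray with the conjugate of P(z) reduces the claim to the monotonicity of a
real function, and s = 1 gives |P z|² ≤ |P z| N. If P(z) = 0 this is empty, and N ≥ 0 follows from
its nonnegative derivative. -/
theorem norm_le_of_norm_deriv_le {P K : ℂ → ℂ} {N n : ℝ → ℝ}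
    (hP : ∀ z ∈ unitDisk, HasDerivAt P (K z) z) (hP0 : P 0 = 0)
    (hN : ∀ r ∈ Set.Ioo (0 : ℝ) 1, HasDerivAt N (n r) r) (hNc : ContinuousOn N (Set.Ico 0 1))
    (hN0 : N 0 = 0) (hn : ∀ z ∈ unitDisk, z ≠ 0 → ‖z * K z‖ ≤ ‖z‖ * n ‖z‖)
    {z : ℂ} (hz : z ∈ unitDisk) : ‖P z‖ ≤ N ‖z‖ := by
  by_cases hz0 : z = 0
  · simp [hz0, hP0, hN0]
  have hzn : 0 < ‖z‖ := norm_pos_iff.2 hz0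
  have hz1 := mem_unitDisk.1 hz
  have hnorm : ∀ s : ℝ, 0 ≤ s → ‖(s : ℂ) * z‖ = s * ‖z‖ := fun s hs => by
    rw [norm_mul, Complex.norm_real, Real.norm_of_nonneg hs]
  have hmem : ∀ s ∈ Set.Icc (0 : ℝ) 1, (s : ℂ) * z ∈ unitDisk := by
    intro s hs
    rw [mem_unitDisk, hnorm s hs.1]
    nlinarith [hs.1, hs.2]
  set c := starRingEnd ℂ (P z) with hc
  have hd1 : ∀ s ∈ Set.Icc (0 : ℝ) 1,
      HasDerivAt (fun s : ℝ => (c * P ((s : ℂ) * z)).re) (c * (K ((s : ℂ) * z) * z)).re s := by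
    intro s hs
    have h1 : HasDerivAt (fun s : ℝ => (s : ℂ) * z) z s := by
      simpa using (hasDerivAt_id s).ofReal_comp.mul_const z
    exact Complex.reCLM.hasFDerivAt.comp_hasDerivAt s
      ((HasDerivAt.comp (h₂ := P) s (hP _ (hmem s hs)) h1).const_mul c)
  have hd2 : ∀ s ∈ Set.Ioo (0 : ℝ) 1,
      HasDerivAt (fun s : ℝ => ‖P z‖ * N (s * ‖z‖)) (‖P z‖ * (n (s * ‖z‖) * ‖z‖)) s := by
    intro s hs
    refine (HasDerivAt.comp (h₂ := N) (h := fun s => s * ‖z‖) s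
      (hN _ ⟨mul_pos hs.1 hzn, ?_⟩) ?_).const_mul _
    · nlinarith [hs.1, hs.2]
    · simpa using (hasDerivAt_id s).mul_const ‖z‖
  have hanti : AntitoneOn (fun s : ℝ => (c * P ((s : ℂ) * z)).re - ‖P z‖ * N (s * ‖z‖))
      (Set.Icc 0 1) := by
    apply antitoneOn_of_deriv_nonpos (convex_Icc 0 1)
    · refine ContinuousOn.sub (fun s hs => (hd1 s hs).continuousAt.continuousWithinAt)
        (ContinuousOn.mul continuousOn_const (hNc.comp (by fun_prop) fun s hs => ⟨?_, ?_⟩))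
      · exact mul_nonneg hs.1 hzn.le
      · nlinarith [hs.1, hs.2]
    · intro s hs
      rw [interior_Icc] at hs
      exact ((hd1 s (Set.Ioo_subset_Icc_self hs)).sub
        (hd2 s hs)).differentiableAt.differentiableWithinAt
    · intro s hs
      rw [interior_Icc] at hs
      have hsub := (hd1 s (Set.Ioo_subset_Icc_self hs)).sub (hd2 s hs)
      refine hsub.deriv.trans_le ?_
      have hs0 : (s : ℂ) * z ≠ 0 := mul_ne_zero (by exact_mod_cast hs.1.ne') hz0
      have h1 := hn _ (hmem s (Set.Ioo_subset_Icc_self hs)) hs0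
      rw [norm_mul, hnorm s hs.1.le] at h1
      have h2 : ‖K ((s : ℂ) * z)‖ ≤ n (s * ‖z‖) := le_of_mul_le_mul_left h1 (mul_pos hs.1 hzn)
      have h3 := Complex.re_le_norm (c * (K ((s : ℂ) * z) * z))
      rw [norm_mul, norm_mul, hc, RCLike.norm_conj] at h3
      have h4 := mul_le_mul_of_nonneg_left (mul_le_mul_of_nonneg_right h2 hzn.le)
        (norm_nonneg (P z))
      linarith
  have h1 := hanti (Set.left_mem_Icc.2 zero_le_one) (Set.right_mem_Icc.2 zero_le_one) zero_le_one
  have h2 : (c * P z).re = ‖P z‖ ^ 2 := by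
    rw [hc, mul_comm, Complex.mul_conj, Complex.ofReal_re, Complex.normSq_eq_norm_sq]
  simp only [Complex.ofReal_one, one_mul, Complex.ofReal_zero, zero_mul, hP0, hN0, mul_zero,
    Complex.zero_re, sub_zero, h2] at h1
  rcases (norm_nonneg (P z)).eq_or_lt with h3 | h3
  · have hmono : MonotoneOn N (Set.Icc 0 ‖z‖) := by
      apply monotoneOn_of_deriv_nonneg (convex_Icc 0 ‖z‖)
      · exact hNc.mono fun r hr => ⟨hr.1, hr.2.trans_lt hz1⟩
      · intro r hr
        rw [interior_Icc] at hr
        exact (hN r ⟨hr.1, hr.2.trans hz1⟩).differentiableAt.differentiableWithinAt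
      · intro r hr
        rw [interior_Icc] at hr
        rw [(hN r ⟨hr.1, hr.2.trans hz1⟩).deriv]
        have hr1 : ‖(r : ℂ)‖ = r := by rw [Complex.norm_real, Real.norm_of_nonneg hr.1.le]
        have h4 := hn (r : ℂ) (mem_unitDisk.2 (by rw [hr1]; exact hr.2.trans hz1))
          (by exact_mod_cast hr.1.ne')
        rw [hr1] at h4
        exact nonneg_of_mul_nonneg_right ((norm_nonneg _).trans h4) hr.1
    rw [← h3, ← hN0]
    exact hmono (Set.left_mem_Icc.2 hzn.le) (Set.right_mem_Icc.2 hzn.le) hzn.le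
  · nlinarith

/-! ### Criteria for the bound and its sharpness -/

theorem strictMonoOn_of_hasDerivAt_pos {g d : ℝ → ℝ}
    (hg : ∀ r ∈ Set.Ioo (0 : ℝ) 1, HasDerivAt g (d r) r) (hgc : ContinuousOn g (Set.Icc 0 1))
    (hd : ∀ r ∈ Set.Ioo (0 : ℝ) 1, 0 < d r) : StrictMonoOn g (Set.Icc 0 1) := by
  apply strictMonoOn_of_deriv_pos (convex_Icc 0 1) hgc
  intro r hr
  rw [interior_Icc] at hr
  rw [(hg r hr).deriv]
  exact hd r hr

/-- If `g(r) = ∫₀ʳ (1 - h(-t)) / t dt`, the values `h(w)` on the real axis with `|w| ≤ r` are at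
least `h(-r)`, and `|h(w) - 1|` has a small enough radial majorant, then the implication holds
for `β ≥ g(1) / γ`. -/
theorem implication_of_barrier {h : ℂ → ℂ} {g d N n : ℝ → ℝ} {M β : ℝ}
    (hh : DifferentiableOn ℂ h unitDisk) (h0 : h 0 = 1)
    (hg : ∀ r ∈ Set.Ioo (0 : ℝ) 1, HasDerivAt g (d r) r) (hgc : ContinuousOn g (Set.Icc 0 1))
    (hg0 : g 0 = 0) (hd : ∀ r ∈ Set.Ioo (0 : ℝ) 1, 0 < d r)
    (hB : ∀ w r, ‖w‖ ≤ r → 0 < r → r < 1 → (h w).im = 0 → 1 - r * d r ≤ (h w).re)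
    (hN : ∀ r ∈ Set.Ioo (0 : ℝ) 1, HasDerivAt N (n r) r) (hNc : ContinuousOn N (Set.Ico 0 1))
    (hN0 : N 0 = 0) (hn : ∀ w r, ‖w‖ ≤ r → 0 < r → r < 1 → ‖h w - 1‖ ≤ r * n r)
    (hNM : ∀ r ∈ Set.Ico (0 : ℝ) 1, N r ≤ M) (hM : M * gammaConst ≤ 1.08 * g 1)
    (hβ : g 1 / gammaConst ≤ β) : Implication h β := by
  intro p hp hs
  have hγ := gammaConst_pos
  have hmono := strictMonoOn_of_hasDerivAt_pos hg hgc hd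
  have hg1 : 0 < g 1 := by
    rw [← hg0]
    exact hmono (Set.left_mem_Icc.2 zero_le_one) (Set.right_mem_Icc.2 zero_le_one) one_pos
  have hβ0 : 0 < β := (div_pos hg1 hγ).trans_le hβ
  have hβγ : g 1 ≤ β * gammaConst := (div_le_iff₀ hγ).1 hβ
  obtain ⟨w, P, K, hw, hP0, hP⟩ := exists_log_of_subordinate hβ0 hh h0 hp hs
  refine subordinate_cardioid hp fun z hz => ?_
  -- Schwarz lemma.
  have hsch : ∀ z ∈ unitDisk, ‖w z‖ ≤ ‖z‖ := fun z hz =>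
    Complex.norm_le_norm_of_mapsTo_ball hw.1
      (fun z hz => Metric.ball_subset_closedBall (hw.2.1 hz)) hw.2.2 (mem_unitDisk.1 hz)
  rw [(hP z hz).2.2]
  apply exp_mem_cardioid_image
  · have h1 := norm_le_of_norm_deriv_le (P := P) (K := K) (N := fun r => N r / β)
      (n := fun r => n r / β)
      (fun z hz => (hP z hz).1) hP0 (fun r hr => (hN r hr).div_const β)
      (hNc.div_const β) (by simp [hN0]) (by
        intro v hv hv0
        rw [(hP v hv).2.1, norm_div, Complex.norm_real, Real.norm_of_nonneg hβ0.le,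
          ← mul_div_assoc]
        exact div_le_div_of_nonneg_right
          (hn _ _ (hsch v hv) (norm_pos_iff.2 hv0) (mem_unitDisk.1 hv)) hβ0.le) hz
    refine h1.trans ?_
    rw [div_le_iff₀ hβ0]
    refine (hNM _ ⟨norm_nonneg z, mem_unitDisk.1 hz⟩).trans ?_
    refine le_of_mul_le_mul_right ?_ hγ
    linarith
  · have h1 := neg_barrier_le_re (P := P) (K := K) (g := fun r => g r / β) (d := fun r => d r / β)
      (fun z hz => (hP z hz).1) hP0 (fun r hr => (hg r hr).div_const β)
      ((hgc.mono Set.Ico_subset_Icc_self).div_const β) (by simp [hg0])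
      (fun r hr => div_pos (hd r hr) hβ0) (by
        intro v hv hv0 him
        rw [(hP v hv).2.1] at him ⊢
        rw [Complex.div_ofReal_im, div_eq_zero_iff, or_iff_left hβ0.ne', Complex.sub_im,
          Complex.one_im, sub_zero] at him
        have := hB _ _ (hsch v hv) (norm_pos_iff.2 hv0) (mem_unitDisk.1 hv) him
        rw [Complex.div_ofReal_re, ← mul_div_assoc, ← neg_div, Complex.sub_re, Complex.one_re]
        exact div_le_div_of_nonneg_right (by linarith) hβ0.le) hz
    -- Strict growth of g up to 1 is what yields the strict inequality Re P > -γ even at the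
    -- endpoint β = g(1)/γ.
    have h2 := hmono ⟨norm_nonneg z, (mem_unitDisk.1 hz).le⟩ (Set.right_mem_Icc.2 zero_le_one)
      (mem_unitDisk.1 hz)
    have h3 : g ‖z‖ / β < gammaConst := by rw [div_lt_iff₀ hβ0]; linarith
    linarith

/-- The extremal function is p = e^G with zG' = (h - 1)/β. Since G(-r) = -g(r)/β, an r with g(r) =
βγ makes p(-r) the cusp value. -/
theorem not_implication_of_lt {h : ℂ → ℂ} {g d : ℝ → ℝ} {β : ℝ}
    (hh : DifferentiableOn ℂ h unitDisk) (h0 : h 0 = 1)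
    (hg : ∀ r ∈ Set.Ioo (0 : ℝ) 1, HasDerivAt g (d r) r) (hgc : ContinuousOn g (Set.Icc 0 1))
    (hg0 : g 0 = 0) (hhd : ∀ r ∈ Set.Ioo (0 : ℝ) 1, h (-(r : ℂ)) = 1 - r * d r)
    (hβ0 : 0 < β) (hβ : β < g 1 / gammaConst) : ¬ Implication h β := by
  intro himp
  have hβ' : (β : ℂ) ≠ 0 := by exact_mod_cast hβ0.ne'
  have hγ := gammaConst_pos
  obtain ⟨G, K, hG0, -, hGK⟩ := exists_logarithmic_primitive (f := fun z => (h z - 1) / β)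
    ((hh.sub_const 1).div_const _) (by simp [h0])
  have hp : (fun z => Complex.exp (G z)) ∈ ClassA0 :=
    ⟨fun z hz => (hGK z hz).1.cexp.differentiableAt.differentiableWithinAt, by simp [hG0]⟩
  have hs : Subordinate (Phi β fun z => Complex.exp (G z)) h := by
    refine ⟨id, ⟨differentiableOn_id, fun z hz => hz, rfl⟩, fun z hz => ?_⟩
    have h1 : z * (Complex.exp (G z) * K z) / Complex.exp (G z) = z * K z := by
      field_simp [Complex.exp_ne_zero]
    rw [Phi, (hGK z hz).1.cexp.deriv, h1, (hGK z hz).2, mul_div_cancel₀ _ hβ']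
    simp
  obtain ⟨w, hw, hpw⟩ := himp _ hp hs
  obtain ⟨r, hr, hgr⟩ := intermediate_value_Ioo zero_le_one hgc
    (show β * gammaConst ∈ Set.Ioo (g 0) (g 1) from
      ⟨by rw [hg0]; positivity, (lt_div_iff₀ hγ).1 hβ⟩)
  have hmem : ∀ s ∈ Set.Ico (0 : ℝ) 1, -(s : ℂ) ∈ unitDisk := by
    intro s hs
    rw [mem_unitDisk, norm_neg, Complex.norm_real, Real.norm_of_nonneg hs.1]
    exact hs.2
  have hd0 : ∀ s ∈ Set.Ico (0 : ℝ) 1,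
      HasDerivAt (fun s : ℝ => G (-(s : ℂ))) (-K (-(s : ℂ))) s := by
    intro s hs
    have h1 : HasDerivAt (fun s : ℝ => -(s : ℂ)) (-1) s := by
      exact ((hasDerivAt_id s).ofReal_comp.neg).congr_deriv (by simp)
    exact (HasDerivAt.comp (h₂ := G) s (hGK _ (hmem s hs)).1 h1).congr_deriv (by ring)
  have hK : ∀ s ∈ Set.Ioo (0 : ℝ) 1, -K (-(s : ℂ)) = ((-(d s / β) : ℝ) : ℂ) := by
    intro s hs
    have h1 := (hGK _ (hmem s ⟨hs.1.le, hs.2⟩)).2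
    rw [hhd s hs] at h1
    have h2 : (s : ℂ) ≠ 0 := by exact_mod_cast hs.1.ne'
    apply mul_left_cancel₀ h2
    push_cast
    linear_combination h1
  have hval : G (-(r : ℂ)) = ((-gammaConst : ℝ) : ℂ) := by
    have hsub : ∀ s ∈ Set.Icc 0 r, s ∈ Set.Ico (0 : ℝ) 1 := fun s hs =>
      ⟨hs.1, hs.2.trans_lt hr.2⟩
    have hcont : ContinuousOn (fun s : ℝ => G (-(s : ℂ))) (Set.Icc 0 r) := fun s hs =>
      (hd0 s (hsub s hs)).continuousAt.continuousWithinAt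
    apply Complex.ext
    -- Re G(-s) + g(s)/β has zero derivative, so the mean value theorem shows that its values at 0
    -- and r agree.
    · obtain ⟨c, hc, h1⟩ := exists_hasDerivAt_eq_slope
        (fun s : ℝ => (G (-(s : ℂ))).re + g s / β) (fun s => (-K (-(s : ℂ))).re + d s / β) hr.1
        ((Complex.continuous_re.comp_continuousOn hcont).add
          ((hgc.mono fun s hs => Set.Ico_subset_Icc_self (hsub s hs)).div_const β))
        (fun s hs => (Complex.reCLM.hasFDerivAt.comp_hasDerivAt s
          (hd0 s (hsub s (Set.Ioo_subset_Icc_self hs)))).add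
            ((hg s ⟨hs.1, hs.2.trans hr.2⟩).div_const β))
      rw [hK c ⟨hc.1, hc.2.trans hr.2⟩, Complex.ofReal_re, neg_add_cancel, eq_comm,
        div_eq_zero_iff] at h1
      have h2 := h1.resolve_right (by rw [sub_zero]; exact hr.1.ne')
      rw [hgr, mul_div_cancel_left₀ _ hβ0.ne'] at h2
      simp only [Complex.ofReal_zero, neg_zero, hG0, Complex.zero_re, hg0, zero_div, add_zero,
        sub_zero] at h2
      rw [Complex.ofReal_re]
      linarith
    · obtain ⟨c, hc, h1⟩ := exists_hasDerivAt_eq_slope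
        (fun s : ℝ => (G (-(s : ℂ))).im) (fun s => (-K (-(s : ℂ))).im) hr.1
        (Complex.continuous_im.comp_continuousOn hcont)
        (fun s hs => Complex.imCLM.hasFDerivAt.comp_hasDerivAt s
          (hd0 s (hsub s (Set.Ioo_subset_Icc_self hs))))
      rw [hK c ⟨hc.1, hc.2.trans hr.2⟩, Complex.ofReal_im, eq_comm, div_eq_zero_iff] at h1
      have h2 := h1.resolve_right (by rw [sub_zero]; exact hr.1.ne')
      simpa [hG0] using h2
  refine cusp_notMem_cardioid_image ⟨w (-(r : ℂ)), hw.2.1 (hmem r ⟨hr.1.le, hr.2⟩), ?_⟩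
  refine (hpw _ (hmem r ⟨hr.1.le, hr.2⟩)).symm.trans ?_
  simp only
  rw [hval, ← Complex.ofReal_exp, exp_neg_gammaConst]
  push_cast
  rfl

theorem isSharpBound_of_barrier {h : ℂ → ℂ} {g d N n : ℝ → ℝ} {M : ℝ}
    (hh : DifferentiableOn ℂ h unitDisk) (h0 : h 0 = 1)
    (hg : ∀ r ∈ Set.Ioo (0 : ℝ) 1, HasDerivAt g (d r) r) (hgc : ContinuousOn g (Set.Icc 0 1))
    (hg0 : g 0 = 0) (hd : ∀ r ∈ Set.Ioo (0 : ℝ) 1, 0 < d r)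
    (hhd : ∀ r ∈ Set.Ioo (0 : ℝ) 1, h (-(r : ℂ)) = 1 - r * d r)
    (hB : ∀ w r, ‖w‖ ≤ r → 0 < r → r < 1 → (h w).im = 0 → 1 - r * d r ≤ (h w).re)
    (hN : ∀ r ∈ Set.Ioo (0 : ℝ) 1, HasDerivAt N (n r) r) (hNc : ContinuousOn N (Set.Ico 0 1))
    (hN0 : N 0 = 0) (hn : ∀ w r, ‖w‖ ≤ r → 0 < r → r < 1 → ‖h w - 1‖ ≤ r * n r)
    (hNM : ∀ r ∈ Set.Ico (0 : ℝ) 1, N r ≤ M) (hM : M * gammaConst ≤ 1.08 * g 1) :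
    IsSharpBound h (g 1 / gammaConst) :=
  ⟨fun _ => implication_of_barrier hh h0 hg hgc hg0 hd hB hN hNc hN0 hn hNM hM,
    fun _ => not_implication_of_lt hh h0 hg hgc hg0 hhd⟩

theorem gammaConst_le : gammaConst ≤ 0.4588 := by
  have h1 := Real.exp_one_gt_d9
  rw [gammaConst, Real.log_le_iff_le_exp (div_pos (by linarith) (by linarith))]
  have h2 := quartic_le_exp (s := 0.4588) (by norm_num)
  rw [div_le_iff₀ (by linarith)]
  norm_num at h2
  nlinarith

/-- The case where `1 - h(-r)` is itself a majorant of `|h - 1|`. -/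
theorem isSharpBound_of_norm_le {h : ℂ → ℂ} {g d : ℝ → ℝ}
    (hh : DifferentiableOn ℂ h unitDisk) (h0 : h 0 = 1)
    (hg : ∀ r ∈ Set.Ioo (0 : ℝ) 1, HasDerivAt g (d r) r) (hgc : ContinuousOn g (Set.Icc 0 1))
    (hg0 : g 0 = 0) (hd : ∀ r ∈ Set.Ioo (0 : ℝ) 1, 0 < d r)
    (hhd : ∀ r ∈ Set.Ioo (0 : ℝ) 1, h (-(r : ℂ)) = 1 - r * d r)
    (hn : ∀ w r, ‖w‖ ≤ r → 0 < r → r < 1 → ‖h w - 1‖ ≤ r * d r) :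
    IsSharpBound h (g 1 / gammaConst) := by
  have hmono := strictMonoOn_of_hasDerivAt_pos hg hgc hd
  have hg1 : 0 < g 1 := by
    rw [← hg0]
    exact hmono (Set.left_mem_Icc.2 zero_le_one) (Set.right_mem_Icc.2 zero_le_one) one_pos
  refine isSharpBound_of_barrier hh h0 hg hgc hg0 hd hhd (fun w r h1 h2 h3 _ => ?_) hg
    (hgc.mono Set.Ico_subset_Icc_self) hg0 hn (M := g 1) (fun r hr => ?_) ?_
  · have := (Complex.abs_re_le_norm (h w - 1)).trans (hn w r h1 h2 h3)
    rw [Complex.sub_re, Complex.one_re] at this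
    linarith [(abs_le.1 this).1]
  · exact hmono.monotoneOn (Set.Ico_subset_Icc_self hr) (Set.right_mem_Icc.2 zero_le_one) hr.2.le
  · nlinarith [gammaConst_le]

/-- The case where `|h(w) - 1| ≤ |w| + |w|²`. -/
theorem isSharpBound_of_norm_le_quadratic {h : ℂ → ℂ} {g d : ℝ → ℝ}
    (hh : DifferentiableOn ℂ h unitDisk) (h0 : h 0 = 1)
    (hg : ∀ r ∈ Set.Ioo (0 : ℝ) 1, HasDerivAt g (d r) r) (hgc : ContinuousOn g (Set.Icc 0 1))
    (hg0 : g 0 = 0) (hd : ∀ r ∈ Set.Ioo (0 : ℝ) 1, 0 < d r)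
    (hhd : ∀ r ∈ Set.Ioo (0 : ℝ) 1, h (-(r : ℂ)) = 1 - r * d r)
    (hB : ∀ w r, ‖w‖ ≤ r → 0 < r → r < 1 → (h w).im = 0 → 1 - r * d r ≤ (h w).re)
    (hn : ∀ w, ‖w‖ < 1 → ‖h w - 1‖ ≤ ‖w‖ + ‖w‖ ^ 2) (hg1 : 0.64 ≤ g 1) :
    IsSharpBound h (g 1 / gammaConst) := by
  refine isSharpBound_of_barrier hh h0 hg hgc hg0 hd hhd hB (N := fun r => r + r ^ 2 / 2)
    (n := fun r => 1 + r) (fun r _ => ?_) (by fun_prop) (by simp) (fun w r h1 h2 h3 => ?_)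
    (M := 3 / 2) (fun r hr => ?_) ?_
  · exact ((hasDerivAt_id' r).add (((hasDerivAt_id' r).pow 2).div_const 2)).congr_deriv
      (by simp)
  · have := hn w (h1.trans_lt h3)
    nlinarith [norm_nonneg w]
  · have := hr.1
    have := hr.2
    nlinarith
  -- 1.5 · 0.4588 ≤ 1.08 · 0.64, which is where 0.64 comes from.
  · linarith [gammaConst_le]

/-! ### Functions for which |h - 1| is largest at the point -r -/

theorem janowski_isSharpBound {A B : ℝ} (hB : 0 < B) (hBA : B < A) (hA : A < 1) :
    IsSharpBound (janowski A B)
      ((A - B) * Real.log (1 / (1 - B)) / (gammaConst * B)) := by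
  have hB1 : B < 1 := hBA.trans hA
  have hpos : ∀ r : ℝ, r ≤ 1 → 0 < 1 - B * r := fun r hr => by nlinarith
  have hden : ∀ w : ℂ, ‖w‖ ≤ 1 → 1 - B * ‖w‖ ≤ ‖1 + (B : ℂ) * w‖ := by
    intro w hw
    have h1 := norm_sub_norm_le (1 : ℂ) (-((B : ℂ) * w))
    rw [norm_neg, norm_mul, Complex.norm_real, Real.norm_of_nonneg hB.le, norm_one,
      sub_neg_eq_add] at h1
    exact h1
  have hne : ∀ w : ℂ, ‖w‖ ≤ 1 → 1 + (B : ℂ) * w ≠ 0 := fun w hw =>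
    norm_pos_iff.1 ((hpos _ hw).trans_le (hden w hw))
  have key := isSharpBound_of_norm_le (h := janowski A B)
    (g := fun r => -((A - B) / B * Real.log (1 - B * r))) (d := fun r => (A - B) / (1 - B * r))
    ?_ (by simp [janowski]) ?_ ?_ (by simp) ?_ ?_ ?_
  · convert key using 1
    simp only [mul_one, one_div, Real.log_inv]
    field_simp
  · intro w hw
    have := hne w (mem_unitDisk.1 hw).le
    unfold janowski
    exact DifferentiableAt.differentiableWithinAt (by fun_prop (disch := assumption))
  · intro r hr
    have h1 : HasDerivAt (fun r => 1 - B * r) (-B) r := by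
      simpa using ((hasDerivAt_id r).const_mul B).const_sub 1
    refine ((h1.log (hpos r hr.2.le).ne').const_mul ((A - B) / B)).neg.congr_deriv ?_
    field_simp
  · intro r hr
    have := (hpos r hr.2).ne'
    exact ContinuousAt.continuousWithinAt (by fun_prop (disch := assumption))
  · exact fun r hr => div_pos (by linarith) (hpos r hr.2.le)
  · intro r hr
    have h1 : (1 : ℂ) - B * r ≠ 0 := by exact_mod_cast (hpos r hr.2.le).ne'
    simp only [janowski]
    push_cast
    rw [mul_neg (B : ℂ), ← sub_eq_add_neg, div_eq_iff h1, sub_mul, mul_assoc,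
      div_mul_cancel₀ _ h1]
    ring
  · intro w r h1 h2 h3
    have h4 : janowski A B w - 1 = (A - B) * w / (1 + B * w) := by
      have := hne w (h1.trans h3.le)
      rw [janowski, eq_div_iff this, sub_mul, div_mul_cancel₀ _ this]
      ring
    rw [h4, norm_div, norm_mul, ← Complex.ofReal_sub, Complex.norm_real,
      Real.norm_of_nonneg (by linarith), ← mul_div_assoc]
    have h5 := hden w (h1.trans h3.le)
    refine div_le_div₀ (by nlinarith) (by nlinarith) (hpos r h3.le) (by nlinarith)

/-- The first entry has the larger numerator, as (1 + B)(1 - B) ≤ 1, and the smaller denominator, as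
e/(e - 1) ≤ 1 + e. -/
theorem janowski_max_eq {A B : ℝ} (hB : 0 < B) (hBA : B < A) (hA : A < 1) :
    max ((A - B) * Real.log (1 / (1 - B)) / (gammaConst * B))
      ((A - B) * Real.log (1 + B) / (B * Real.log (1 + Real.exp 1)))
      = (A - B) * Real.log (1 / (1 - B)) / (gammaConst * B) := by
  apply max_eq_left
  have hB1 : B < 1 := hBA.trans hA
  have he := Real.exp_one_gt_d9
  have h1 : Real.log (1 + B) ≤ Real.log (1 / (1 - B)) := by
    apply Real.log_le_log (by linarith)
    rw [le_div_iff₀ (by linarith)]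
    nlinarith
  have h2 : gammaConst ≤ Real.log (1 + Real.exp 1) := by
    apply Real.log_le_log (div_pos (by linarith) (by linarith))
    rw [div_le_iff₀ (by linarith)]
    nlinarith
  have h3 : 0 ≤ Real.log (1 + B) := Real.log_nonneg (by linarith)
  have hγ := gammaConst_pos
  rw [mul_comm B]
  apply div_le_div₀ (mul_nonneg (by linarith) (h3.trans h1)) _ (mul_pos hγ hB) (by gcongr)
  exact mul_le_mul_of_nonneg_left h1 (by linarith)

theorem phiAlpha_isSharpBound {α : ℝ} (hα0 : 0 < α) (hα1 : α < 1) :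
    IsSharpBound (phiAlpha α) (Real.log ((1 + √α) / (1 - √α)) / (2 * gammaConst * √α)) := by
  have hs0 : 0 < √α := Real.sqrt_pos.2 hα0
  have hs1 : √α < 1 := by rwa [Real.sqrt_lt' one_pos, one_pow]
  have hsq : √α ^ 2 = α := Real.sq_sqrt hα0.le
  have hpos : ∀ r : ℝ, 0 ≤ r → r ≤ 1 → 0 < 1 - α * r ^ 2 := fun r h0 hr => by
    have : r ^ 2 ≤ 1 := pow_le_one₀ h0 hr
    nlinarith
  have hden : ∀ w : ℂ, 1 - α * ‖w‖ ^ 2 ≤ ‖1 - (α : ℂ) * w ^ 2‖ := by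
    intro w
    have h1 := norm_sub_norm_le (1 : ℂ) ((α : ℂ) * w ^ 2)
    rwa [norm_mul, norm_pow, Complex.norm_real, Real.norm_of_nonneg hα0.le, norm_one] at h1
  have hne : ∀ w : ℂ, ‖w‖ ≤ 1 → 1 - (α : ℂ) * w ^ 2 ≠ 0 := fun w hw =>
    norm_pos_iff.1 ((hpos _ (norm_nonneg w) hw).trans_le (hden w))
  have hm : ∀ r : ℝ, r ≤ 1 → 1 - √α * r ≠ 0 := fun r hr =>
    ne_of_gt (by nlinarith : (0 : ℝ) < 1 - √α * r)
  have hp : ∀ r : ℝ, 0 ≤ r → 1 + √α * r ≠ 0 := fun r hr => by positivity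
  have key := isSharpBound_of_norm_le (h := phiAlpha α)
    (g := fun r => (Real.log (1 + √α * r) - Real.log (1 - √α * r)) / (2 * √α))
    (d := fun r => 1 / (1 - α * r ^ 2)) ?_ (by simp [phiAlpha]) ?_ ?_ (by simp) ?_ ?_ ?_
  · convert key using 1
    simp only [mul_one]
    rw [Real.log_div (by positivity) (by linarith)]
    field_simp
  · intro w hw
    have := hne w (mem_unitDisk.1 hw).le
    unfold phiAlpha
    exact DifferentiableAt.differentiableWithinAt (by fun_prop (disch := assumption))
  · intro r hr
    have h1 : HasDerivAt (fun r => 1 - √α * r) (-√α) r := by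
      simpa using ((hasDerivAt_id r).const_mul √α).const_sub 1
    have h2 : HasDerivAt (fun r => 1 + √α * r) (√α) r := by
      simpa using ((hasDerivAt_id r).const_mul √α).const_add 1
    refine (((h2.log (hp r hr.1.le)).sub (h1.log (hm r hr.2.le))).div_const _).congr_deriv ?_
    have h3 := hm r hr.2.le
    have h4 := hp r hr.1.le
    have h5 : 1 - α * r ^ 2 = (1 - √α * r) * (1 + √α * r) := by
      linear_combination r ^ 2 * hsq
    rw [h5]
    field_simp
    ring
  · intro r hr
    have h1 := hm r hr.2
    have h2 := hp r hr.1
    exact ContinuousAt.continuousWithinAt (by fun_prop (disch := assumption))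
  · exact fun r hr => div_pos one_pos (hpos r hr.1.le hr.2.le)
  · intro r hr
    have h1 : (1 : ℂ) - α * r ^ 2 ≠ 0 := by exact_mod_cast (hpos r hr.1.le hr.2.le).ne'
    simp only [phiAlpha]
    push_cast
    rw [neg_sq]
    ring
  · intro w r h1 h2 h3
    rw [phiAlpha, add_sub_cancel_left, norm_div, mul_one_div]
    have h5 := hden w
    have h6 : ‖w‖ ^ 2 ≤ r ^ 2 := pow_le_pow_left₀ (norm_nonneg w) h1 2
    refine div_le_div₀ h2.le h1 (hpos r h2.le h3.le) (by nlinarith)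

/-- Re √a = √((|a| + Re a)/2) ≥ √(Re a). -/
theorem sqrt_le_re_sqrt {x : ℝ} {a : ℂ} (hxa : x ≤ a.re) : √x ≤ (Complex.sqrt a).re := by
  rw [Complex.sqrt, Complex.cpow_inv_two_re]
  apply Real.sqrt_le_sqrt
  linarith [Complex.re_le_norm a]

theorem sqrt_sq (a : ℂ) : Complex.sqrt a ^ 2 = a := by
  have := Complex.cpow_nat_inv_pow a (two_ne_zero)
  simpa only [Complex.sqrt, Nat.cast_ofNat] using this

theorem sqrt_ofReal {x : ℝ} (hx : 0 ≤ x) : Complex.sqrt (x : ℂ) = (√x : ℝ) := by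
  rw [Complex.sqrt, Real.sqrt_eq_rpow, Complex.ofReal_cpow hx]
  norm_num

theorem lemniscate_isSharpBound :
    IsSharpBound lemniscate (2 * (1 - Real.log 2) / gammaConst) := by
  have hre : ∀ w : ℂ, 1 - ‖w‖ ≤ (1 + w).re := fun w => by
    rw [Complex.add_re, Complex.one_re]
    linarith [(abs_le.1 (Complex.abs_re_le_norm w)).1]
  have hd0 : ∀ r : ℝ, (0 : ℝ) < 1 + √(1 - r) := fun r => by positivity
  have key := isSharpBound_of_norm_le (h := lemniscate)
    (g := fun r => 2 * (1 - √(1 - r)) + 2 * Real.log ((1 + √(1 - r)) / 2))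
    (d := fun r => 1 / (1 + √(1 - r))) ?_ (by simp [lemniscate]) ?_ ?_ (by simp) ?_ ?_ ?_
  · convert key using 2
    simp
    ring
  · intro w hw
    have h1 : 1 + w ∈ Complex.slitPlane := Or.inl (by linarith [hre w, mem_unitDisk.1 hw])
    unfold lemniscate
    exact ((Complex.differentiableAt_sqrt h1).comp w (by fun_prop)).differentiableWithinAt
  · intro r hr
    have h0 : 1 - r ≠ 0 := by linarith [hr.2]
    have h1 : HasDerivAt (fun r => √(1 - r)) (-1 / (2 * √(1 - r))) r :=
      ((hasDerivAt_id' r).const_sub 1).sqrt h0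
    have hs : 0 < √(1 - r) := Real.sqrt_pos.2 (by linarith [hr.2])
    refine (((h1.const_sub 1).const_mul 2).add
      ((((h1.const_add 1).div_const 2).log (by positivity)).const_mul 2)).congr_deriv ?_
    field_simp
    ring
  · intro r hr
    have h1 : (1 + √(1 - r)) / 2 ≠ 0 := (by have := hd0 r; positivity)
    exact ContinuousAt.continuousWithinAt (by fun_prop (disch := assumption))
  · exact fun r _ => div_pos one_pos (hd0 r)
  · intro r hr
    have h1 : (1 : ℂ) + -(r : ℂ) = ((1 - r : ℝ) : ℂ) := by push_cast; ring
    have h2 : (1 : ℝ) - r ≥ 0 := by linarith [hr.2]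
    rw [lemniscate, h1, sqrt_ofReal h2]
    have h3 : √(1 - r) = 1 - r * (1 / (1 + √(1 - r))) := by
      have := hd0 r
      have h4 := Real.sq_sqrt h2
      field_simp
      linear_combination h4
    exact_mod_cast h3
  · intro w r h1 h2 h3
    -- Rationalizing moves the estimate to |√(1+w) + 1|, which is at least its real part, hence at
    -- least 1 + √(1-r).
    have h4 : (lemniscate w - 1) * (lemniscate w + 1) = w := by
      have := sqrt_sq (1 + w)
      rw [lemniscate]
      linear_combination this
    have h5 : √(1 - r) ≤ (lemniscate w).re := sqrt_le_re_sqrt (by linarith [hre w])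
    have h6 : 1 + √(1 - r) ≤ ‖lemniscate w + 1‖ := by
      refine le_trans ?_ (Complex.re_le_norm _)
      rw [Complex.add_re, Complex.one_re]
      linarith
    have h7 := congrArg norm h4
    rw [norm_mul] at h7
    rw [mul_one_div, le_div_iff₀ (hd0 r)]
    exact (mul_le_mul_of_nonneg_left h6 (norm_nonneg _)).trans (h7.le.trans h1)

/-! ### The function `phiZero` -/

theorem kConst_sq : kConst ^ 2 = 2 * kConst + 1 := by
  have := Real.sq_sqrt (show (0 : ℝ) ≤ 2 by norm_num)
  rw [kConst]
  linear_combination this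

theorem sqrt_two_mem : √2 ∈ Set.Ioo 1.41421356 1.41421357 :=
  ⟨Real.lt_sqrt_of_sq_lt (by norm_num), (Real.sqrt_lt' (by norm_num)).2 (by norm_num)⟩

theorem one_div_kConst : 1 / kConst = √2 - 1 := by
  have h1 := sqrt_two_mem.1
  have h2 := Real.sq_sqrt (show (0 : ℝ) ≤ 2 by norm_num)
  rw [kConst, div_eq_iff (by linarith)]
  linear_combination -h2

/-- A real value 1 + x means w² + k(1 + x)w = xk², a real quadratic in w. A nonreal w has its
conjugate as the other root, so |w|² = -xk² and x ≥ -r²/k²; real w are compared with -r directly. -/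
theorem phiZero_re_ge {w : ℂ} {r : ℝ} (hw : ‖w‖ ≤ r) (hr0 : 0 < r) (hr1 : r < 1)
    (him : (phiZero w).im = 0) :
    1 - r * (1 / kConst * ((kConst - r) / (kConst + r))) ≤ (phiZero w).re := by
  have hk : 2 < kConst := by rw [kConst]; linarith [sqrt_two_mem.1]
  have hk2 := kConst_sq
  set k := kConst with hkdef
  obtain ⟨x, hx⟩ : ∃ x, x = (phiZero w).re - 1 := ⟨_, rfl⟩
  have hkr : 0 < k + r := by linarith
  have hk0 : (k : ℂ) ≠ 0 := by exact_mod_cast (by linarith : k ≠ 0)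
  have hkw : (k : ℂ) - w ≠ 0 := by
    intro h
    rw [← sub_eq_zero.1 h, Complex.norm_real, Real.norm_of_nonneg (by linarith)] at hw
    linarith
  have hphi : phiZero w = ((1 + x : ℝ) : ℂ) := by
    apply Complex.ext
    · rw [Complex.ofReal_re, hx]; ring
    · rw [Complex.ofReal_im, him]
  have heq : w ^ 2 + k * (1 + x) * w = x * k ^ 2 := by
    have h1 : w / (k : ℂ) * ((k + w) / (k - w)) = x := by
      have : phiZero w = 1 + w / (k : ℂ) * ((k + w) / (k - w)) := rfl
      rw [hphi] at this
      push_cast at this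
      linear_combination -this
    rw [div_mul_div_comm, div_eq_iff (mul_ne_zero hk0 hkw)] at h1
    linear_combination h1
  clear_value k
  have hre := congrArg Complex.re heq
  have hi := congrArg Complex.im heq
  have hnorm : w.re ^ 2 + w.im ^ 2 ≤ r ^ 2 := by
    have h1 := Complex.sq_norm w
    rw [Complex.normSq_apply] at h1
    nlinarith [norm_nonneg w]
  simp only [pow_two, Complex.add_re, Complex.mul_re, Complex.ofReal_re, Complex.ofReal_im,
    Complex.add_im, Complex.mul_im, Complex.one_re, Complex.one_im] at hre hi
  ring_nf at hre hi
  suffices h : -(r * (k - r)) ≤ x * (k * (k + r)) by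
    have h2 : r * (1 / k * ((k - r) / (k + r))) = r * (k - r) / (k * (k + r)) := by
      field_simp
    have h3 : -x ≤ r * (k - r) / (k * (k + r)) := by
      rw [le_div_iff₀ (by positivity)]
      linarith only [h]
    rw [h2]
    linarith only [h3, hx]
  -- This is r²/k² ≤ (r/k)(k - r)/(k + r) after clearing denominators; k = 1 + √2 makes it an
  -- equality at r = 1.
  have hrad : r ^ 2 + 2 * k * r ≤ k ^ 2 := by nlinarith
  by_cases hb : w.im = 0
  · rw [hb] at hre hnorm
    have har : -r ≤ w.re := by nlinarith
    have har' : w.re ≤ r := by nlinarith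
    have hka : 0 < k - w.re := by linarith
    have h1 : x * (k * (k - w.re)) = w.re * (k + w.re) := by linarith
    rcases le_or_gt 0 w.re with h0 | h0
    · have : 0 ≤ x := by
        by_contra hneg
        have h3 : x * (k * (k - w.re)) < 0 := mul_neg_of_neg_of_pos (by linarith) (by positivity)
        nlinarith
      have : 0 ≤ x * (k * (k + r)) := by positivity
      nlinarith
    · have h4 : -(r * (k - r)) * (k - w.re) ≤ w.re * (k + w.re) * (k + r) := by
        have h5 : 0 ≤ (r + w.re) * (k ^ 2 - k * (r - w.re) + r * w.re) := by
          apply mul_nonneg (by linarith)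
          nlinarith
        nlinarith
      refine le_of_mul_le_mul_right ?_ hka
      calc -(r * (k - r)) * (k - w.re) ≤ w.re * (k + w.re) * (k + r) := h4
        _ = x * (k * (k + r)) * (k - w.re) := by rw [← h1]; ring
  · have h1 : 2 * w.re + k * (1 + x) = 0 := by
      apply mul_left_cancel₀ hb
      linarith
    have h2 : x * k ^ 2 = -(w.re ^ 2 + w.im ^ 2) := by
      linear_combination -hre + w.re * h1
    have h3 : -(r ^ 2) ≤ x * k ^ 2 := by linarith
    refine le_of_mul_le_mul_right ?_ (by linarith : (0 : ℝ) < k)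
    have h4 : -(r ^ 2) * (k + r) ≤ x * k ^ 2 * (k + r) := mul_le_mul_of_nonneg_right h3 hkr.le
    nlinarith

theorem phiZero_isSharpBound :
    IsSharpBound phiZero
      ((-1 + 2 * kConst * Real.log (1 + 1 / kConst)) / (gammaConst * kConst)) := by
  have hs := sqrt_two_mem
  have hk : 2 < kConst := by rw [kConst]; linarith [hs.1]
  have hk0 : kConst ≠ 0 := by linarith
  have hk0' : (kConst : ℂ) ≠ 0 := by exact_mod_cast hk0
  have hγ := gammaConst_pos
  have hm : ∀ r : ℝ, r ≤ 1 → 0 < 1 - r / kConst := fun r hr => by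
    rw [sub_pos, div_lt_one (by linarith)]
    linarith
  have hkm : ∀ r : ℝ, r ≤ 1 → kConst - r ≠ 0 := fun r hr => by linarith
  have hkp : ∀ r : ℝ, 0 ≤ r → kConst + r ≠ 0 := fun r hr => by linarith
  have hden : ∀ w : ℂ, kConst - ‖w‖ ≤ ‖(kConst : ℂ) - w‖ := fun w => by
    have := norm_sub_norm_le (kConst : ℂ) w
    rwa [Complex.norm_real, Real.norm_of_nonneg (by linarith)] at this
  have key := isSharpBound_of_barrier (h := phiZero)
    (g := fun r => 2 * Real.log (1 + r / kConst) - r / kConst)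
    (d := fun r => 1 / kConst * ((kConst - r) / (kConst + r)))
    (N := fun r => -2 * Real.log (1 - r / kConst) - r / kConst)
    (n := fun r => 1 / kConst * ((kConst + r) / (kConst - r)))
    (M := -2 * Real.log (1 - 1 / kConst) - 1 / kConst)
    ?_ (by simp [phiZero]) ?_ ?_ (by simp) ?_ ?_ (fun w r h1 h2 h3 => phiZero_re_ge h1 h2 h3)
    ?_ ?_ (by simp) ?_ ?_ ?_
  · convert key using 1
    field_simp
    ring
  · intro w hw
    have h1 : (kConst : ℂ) - w ≠ 0 := norm_pos_iff.1
      (lt_of_lt_of_le (by linarith [mem_unitDisk.1 hw]) (hden w))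
    unfold phiZero
    exact DifferentiableAt.differentiableWithinAt (by fun_prop (disch := assumption))
  · intro r hr
    have h1 : HasDerivAt (fun r => 1 + r / kConst) (1 / kConst) r :=
      ((hasDerivAt_id' r).div_const _).const_add 1
    have h2 : 1 + r / kConst ≠ 0 := by have := hr.1; positivity
    refine (((h1.log h2).const_mul 2).sub ((hasDerivAt_id' r).div_const _)).congr_deriv ?_
    have h3 := hkp r hr.1.le
    field_simp
    ring
  · intro r hr
    have h2 : 1 + r / kConst ≠ 0 := by have := hr.1; positivity
    exact ContinuousAt.continuousWithinAt (by fun_prop (disch := assumption))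
  · intro r hr
    have h1 : 0 < kConst - r := by linarith [hr.2]
    have := hr.1
    positivity
  · intro r hr
    have h1 : (kConst : ℂ) + r ≠ 0 := by exact_mod_cast hkp r hr.1.le
    rw [phiZero, sub_neg_eq_add]
    push_cast
    ring
  · intro r hr
    have h1 : HasDerivAt (fun r => 1 - r / kConst) (-(1 / kConst)) r :=
      ((hasDerivAt_id' r).div_const _).const_sub 1
    have h2 := (hm r hr.2.le).ne'
    refine (((h1.log h2).const_mul (-2)).sub ((hasDerivAt_id' r).div_const _)).congr_deriv ?_
    have h3 := hkm r hr.2.le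
    have h4 : 1 - r / kConst = (kConst - r) / kConst := by field_simp
    rw [h4]
    field_simp
    ring
  · intro r hr
    have h2 := (hm r hr.2.le).ne'
    exact ContinuousAt.continuousWithinAt (by fun_prop (disch := assumption))
  · intro w r h1 h2 h3
    have h4 := hden w
    have h5 : 0 < kConst - r := by linarith
    rw [phiZero, add_sub_cancel_left, norm_mul, norm_div, norm_div, Complex.norm_real,
      Real.norm_of_nonneg (by linarith : 0 ≤ kConst), ← mul_assoc, mul_one_div]
    have h6 : ‖(kConst : ℂ) + w‖ ≤ kConst + r := by
      refine (norm_add_le _ _).trans ?_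
      rw [Complex.norm_real, Real.norm_of_nonneg (by linarith)]
      linarith
    have h7 : ‖(kConst : ℂ) + w‖ / ‖(kConst : ℂ) - w‖ ≤ (kConst + r) / (kConst - r) :=
      div_le_div₀ (by linarith) h6 h5 (by linarith)
    have h8 : ‖w‖ / kConst ≤ r / kConst := div_le_div_of_nonneg_right h1 (by linarith)
    exact mul_le_mul h8 h7 (by positivity) (by positivity)
  · intro r hr
    have hmono : MonotoneOn (fun r => -2 * Real.log (1 - r / kConst) - r / kConst)
        (Set.Icc 0 1) := by
      intro a ha b hb hab
      have h1 := hm a ha.2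
      have h2 := hm b hb.2
      have h3 := Real.log_le_sub_one_of_pos (div_pos h2 h1)
      rw [Real.log_div h2.ne' h1.ne'] at h3
      have h4 : (1 - b / kConst) / (1 - a / kConst) - 1 ≤ -(b / kConst - a / kConst) := by
        rw [div_sub_one h1.ne', div_le_iff₀ h1]
        have h5 : 0 ≤ b / kConst - a / kConst := by
          rw [← sub_div]
          exact div_nonneg (by linarith) (by linarith)
        have h6 : 0 ≤ a / kConst := div_nonneg ha.1 (by linarith)
        nlinarith
      have h5 : 0 ≤ b / kConst - a / kConst := by
        rw [← sub_div]
        exact div_nonneg (by linarith) (by linarith)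
      simp only
      linarith
    exact hmono (Set.Ico_subset_Icc_self hr) (Set.right_mem_Icc.2 zero_le_one) hr.2.le
  -- The constant 1.08 has little slack here: M γ ≈ 0.3006 against 1.08 g(1) ≈ 0.3012.
  · have h2 := Real.sq_sqrt (show (0 : ℝ) ≤ 2 by norm_num)
    simp only [one_div_kConst]
    have h3 : Real.log (1 + (√2 - 1)) = Real.log 2 / 2 := by
      rw [add_sub_cancel, Real.log_sqrt (by norm_num)]
    have h4 : -Real.log (1 - (√2 - 1)) ≤ 0.535 := by
      rw [← Real.log_inv, Real.log_le_iff_le_exp (inv_pos.2 (by linarith [hs.2]))]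
      have h5 : 1.7073 ≤ Real.exp 0.535 :=
        le_trans (by norm_num [Finset.sum_range_succ, Nat.factorial])
          (Real.sum_le_exp_of_nonneg (x := 0.535) (by norm_num) 6)
      refine le_trans ?_ h5
      rw [inv_le_comm₀ (by linarith [hs.2]) (by norm_num)]
      have := hs.2
      norm_num at this ⊢
      linarith
    rw [h3]
    have h6 := Real.log_two_gt_d9
    have h7 := gammaConst_le
    have h8 : -2 * Real.log (1 - (√2 - 1)) - (√2 - 1) ≤ 0.65579 := by linarith [hs.1]
    have h9 : (-2 * Real.log (1 - (√2 - 1)) - (√2 - 1)) * gammaConst ≤ 0.65579 * 0.4588 := by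
      nlinarith
    have := hs.2
    norm_num at this ⊢ h9 h6
    linarith

/-! ### The crescent function -/

theorem crescent_isSharpBound :
    IsSharpBound crescent ((3 - kConst + Real.log (kConst / 2)) / gammaConst) := by
  have hs := sqrt_two_mem
  have hre : ∀ w : ℂ, ‖w‖ < 1 → 0 < (1 + w ^ 2).re := fun w hw => by
    have h1 := (abs_le.1 (Complex.abs_re_le_norm (w ^ 2))).1
    rw [norm_pow] at h1
    rw [Complex.add_re, Complex.one_re]
    nlinarith [norm_nonneg w]
  have hq : ∀ r : ℝ, (0 : ℝ) < 1 + r ^ 2 := fun r => by positivity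
  have key := isSharpBound_of_norm_le_quadratic (h := crescent)
    (g := fun r => r - (√(1 + r ^ 2) - 1) + Real.log ((1 + √(1 + r ^ 2)) / 2))
    (d := fun r => 1 - r / (1 + √(1 + r ^ 2))) ?_ (by simp [crescent]) ?_ ?_ ?_ ?_ ?_ ?_ ?_ ?_
  · convert key using 2
    norm_num [kConst]
    ring
  · intro w hw
    have h1 : 1 + w ^ 2 ∈ Complex.slitPlane := Or.inl (hre w (mem_unitDisk.1 hw))
    unfold crescent
    exact (differentiableAt_id.add (DifferentiableAt.comp (g := Complex.sqrt)
      (f := fun w => 1 + w ^ 2) w (Complex.differentiableAt_sqrt h1)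
      (by fun_prop))).differentiableWithinAt
  · intro r hr
    have h1 : HasDerivAt (fun r : ℝ => √(1 + r ^ 2)) (2 * r / (2 * √(1 + r ^ 2))) r := by
      have h2 : HasDerivAt (fun r : ℝ => 1 + r ^ 2) (2 * r) r := by
        simpa using ((hasDerivAt_id' r).pow 2).const_add 1
      exact h2.sqrt (hq r).ne'
    have hsp : 0 < √(1 + r ^ 2) := Real.sqrt_pos.2 (hq r)
    refine (((hasDerivAt_id' r).sub (h1.sub_const 1)).add
      (((h1.const_add 1).div_const 2).log (by positivity))).congr_deriv ?_
    field_simp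
    ring
  · intro r hr
    have h1 : (1 + √(1 + r ^ 2)) / 2 ≠ 0 := by positivity
    exact ContinuousAt.continuousWithinAt (by fun_prop (disch := assumption))
  · norm_num
  · intro r hr
    have : 0 < √(1 + r ^ 2) := Real.sqrt_pos.2 (hq r)
    rw [sub_pos, div_lt_one (by linarith)]
    linarith [hr.2]
  · intro r hr
    have h1 : (1 : ℂ) + (-(r : ℂ)) ^ 2 = ((1 + r ^ 2 : ℝ) : ℂ) := by push_cast; ring
    rw [crescent, h1, sqrt_ofReal (hq r).le]
    have h3 : -r + √(1 + r ^ 2) = 1 - r * (1 - r / (1 + √(1 + r ^ 2))) := by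
      have h4 := Real.sq_sqrt (hq r).le
      have h5 : 1 + √(1 + r ^ 2) ≠ 0 := by positivity
      field_simp
      linear_combination h4
    exact_mod_cast h3
  · intro w r h1 h2 h3 him
    have hS := sqrt_sq (1 + w ^ 2)
    have hSre : 0 < (Complex.sqrt (1 + w ^ 2)).re :=
      (Real.sqrt_pos.2 (hre w (h1.trans_lt h3))).trans_le (sqrt_le_re_sqrt le_rfl)
    set S := Complex.sqrt (1 + w ^ 2) with hSdef
    have hv : crescent w = w + S := rfl
    set x := (crescent w).re with hx
    have hcx : w + S = (x : ℂ) := by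
      rw [← hv]
      exact Complex.ext (by simp [hx]) (by simpa using him)
    -- Eliminating the square root from a real value x leaves an equation linear in w, with x ≠ 0,
    -- so w is real; then t + √(1 + t²) is increasing.
    have h4 : (x : ℂ) ^ 2 - 2 * x * w = 1 := by
      have : S = x - w := by linear_combination hcx
      rw [this] at hS
      linear_combination hS
    have h5 := congrArg Complex.im h4
    have h6 := congrArg Complex.re h4
    simp only [pow_two, Complex.sub_re, Complex.sub_im, Complex.mul_re, Complex.mul_im,
      Complex.ofReal_re, Complex.ofReal_im, Complex.re_ofNat, Complex.im_ofNat, Complex.one_re,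
      Complex.one_im] at h5 h6
    ring_nf at h5 h6
    have hx0 : x ≠ 0 := by rintro h0; simp [h0] at h6
    have hwi : w.im = 0 := by
      have : x * w.im = 0 := by linarith
      exact (mul_eq_zero.1 this).resolve_left hx0
    have har := (abs_le.1 ((Complex.abs_re_le_norm w).trans h1)).1
    have hxw : w.re + S.re = x := by simpa using congrArg Complex.re hcx
    have h8 : S.re ^ 2 = 1 + w.re ^ 2 := by
      have : S.re = x - w.re := by linarith
      rw [this]
      linarith
    have h9 : √(1 + r ^ 2) ≤ S.re + (w.re + r) := by
      rw [Real.sqrt_le_left (by linarith)]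
      have h10 : 0 ≤ w.re + S.re := by nlinarith
      nlinarith [mul_nonneg (by linarith : 0 ≤ w.re + r) h10]
    have h10 : 1 - r * (1 - r / (1 + √(1 + r ^ 2))) = -r + √(1 + r ^ 2) := by
      have h4 := Real.sq_sqrt (hq r).le
      have h5 : 1 + √(1 + r ^ 2) ≠ 0 := by positivity
      field_simp
      linear_combination -h4
    rw [h10]
    linarith
  · intro w hw
    have hS := sqrt_sq (1 + w ^ 2)
    have hSre : 0 ≤ (Complex.sqrt (1 + w ^ 2)).re :=
      (Real.sqrt_nonneg _).trans (sqrt_le_re_sqrt le_rfl)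
    rw [crescent]
    set S := Complex.sqrt (1 + w ^ 2) with hSdef
    have h1 : (S - 1) * (S + 1) = w ^ 2 := by linear_combination hS
    have h2 : 1 ≤ ‖S + 1‖ := by
      refine le_trans ?_ (Complex.re_le_norm _)
      rw [Complex.add_re, Complex.one_re]
      linarith
    have h3 := congrArg norm h1
    rw [norm_mul, norm_pow] at h3
    have h4 : ‖S - 1‖ ≤ ‖w‖ ^ 2 := by
      rw [← h3]
      exact le_mul_of_one_le_right (norm_nonneg _) h2
    calc ‖w + S - 1‖ = ‖w + (S - 1)‖ := by ring_nf
      _ ≤ ‖w‖ + ‖S - 1‖ := norm_add_le _ _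
      _ ≤ ‖w‖ + ‖w‖ ^ 2 := by linarith
  · have h1 := Real.one_sub_inv_le_log_of_pos (x := (1 + √2) / 2) (by positivity)
    have h2 := hs.1
    have h3 := hs.2
    have h4 : ((1 + √2) / 2)⁻¹ ≤ 0.83 := by
      rw [inv_le_comm₀ (by positivity) (by norm_num)]
      norm_num at h2 ⊢
      linarith
    norm_num at h1 h2 h3 h4 ⊢
    linarith

/-! ### Sine and exponential: bounds given by series -/

theorem hasSum_of_forall_eq {f g : ℕ → ℝ} {a : ℝ} (h : HasSum f a) (hfg : ∀ n, g n = f n) :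
    HasSum g a := by
  rwa [funext hfg]

/-- Termwise integration, dominated on [0, 1] by |a n|; it identifies g(1) with the stated series.
-/
theorem hasSum_integral_power {a : ℕ → ℝ} {e : ℕ → ℕ} {F : ℝ → ℝ}
    (ha : Summable fun n => |a n|)
    (hF : ∀ x ∈ Set.Ioc (0 : ℝ) 1, HasSum (fun n => a n * x ^ e n) (F x)) :
    HasSum (fun n => a n / (e n + 1)) (∫ x in (0 : ℝ)..1, F x) := by
  have h := intervalIntegral.hasSum_integral_of_dominated_convergence
    (μ := MeasureTheory.volume) (a := 0) (b := 1) (F := fun n x => a n * x ^ e n) (f := F)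
    (fun n _ => |a n|) (fun n => by fun_prop) (fun n => ?_) (by simp [ha]) (by simp) ?_
  · refine hasSum_of_forall_eq h fun n => ?_
    simp [div_eq_mul_inv]
  · refine Filter.Eventually.of_forall fun x hx => ?_
    rw [Set.uIoc_of_le zero_le_one] at hx
    rw [norm_mul, Real.norm_eq_abs, norm_pow, Real.norm_of_nonneg hx.1.le]
    exact mul_le_of_le_one_right (abs_nonneg _) (pow_le_one₀ hx.1.le hx.2)
  · refine Filter.Eventually.of_forall fun x hx => hF x ?_
    rwa [Set.uIoc_of_le zero_le_one] at hx

theorem summable_inv_factorial_comp {e : ℕ → ℕ} (he : Function.Injective e) :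
    Summable fun n => (1 : ℝ) / (e n)! := by
  have := (Real.summable_pow_div_factorial 1).comp_injective he
  simpa [Function.comp_def] using this

theorem sineFun_isSharpBound :
    IsSharpBound sineFun ((1 / gammaConst)
      * ∑' n : ℕ, (-1 : ℝ) ^ (3 * n + 2) / (((2 * n + 1)! : ℝ) * (2 * (n : ℝ) + 1))) := by
  have hpi := Real.pi_gt_three
  have hderiv : ∀ r : ℝ, HasDerivAt (fun r => ∫ x in (0 : ℝ)..r, Real.sinc x) (Real.sinc r) r :=
    fun r => intervalIntegral.integral_hasDerivAt_right
      (Real.continuous_sinc.intervalIntegrable _ _)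
      (Real.continuous_sinc.stronglyMeasurableAtFilter _ _) Real.continuous_sinc.continuousAt
  have hmul : ∀ r : ℝ, 0 < r → r * Real.sinc r = Real.sin r := fun r hr => by
    rw [Real.sinc_of_ne_zero hr.ne', mul_div_cancel₀ _ hr.ne']
  have hsum : HasSum (fun n : ℕ => (-1 : ℝ) ^ (3 * n + 2)
      / (((2 * n + 1)! : ℝ) * (2 * (n : ℝ) + 1))) (∫ x in (0 : ℝ)..1, Real.sinc x) := by
    have h := hasSum_integral_power (a := fun n => (-1 : ℝ) ^ n / ((2 * n + 1)! : ℝ))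
      (e := fun n => 2 * n) (F := Real.sinc) ?_ ?_
    · convert h using 2 with n
      have : (-1 : ℝ) ^ (3 * n + 2) = (-1) ^ n := by
        rw [show 3 * n + 2 = 2 * (n + 1) + n by ring, pow_add, pow_mul]
        simp
      rw [this, div_div]
      push_cast
      rfl
    · simp only [abs_div, abs_pow, abs_neg, abs_one, one_pow, Nat.abs_cast]
      exact summable_inv_factorial_comp (e := fun n => 2 * n + 1) fun a b hab => by simpa using hab
    · intro x hx
      have h1 := (Real.hasSum_sin x).div_const x
      rw [Real.sinc_of_ne_zero hx.1.ne']
      refine hasSum_of_forall_eq h1 fun n => ?_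
      have := hx.1.ne'
      rw [pow_succ]
      field_simp
  have key := isSharpBound_of_norm_le_quadratic (h := sineFun)
    (g := fun r => ∫ x in (0 : ℝ)..r, Real.sinc x) (d := Real.sinc) ?_ (by simp [sineFun])
    (fun r _ => hderiv r) (fun r _ => (hderiv r).continuousAt.continuousWithinAt) (by simp)
    ?_ ?_ ?_ ?_ ?_
  · rw [hsum.tsum_eq, one_div_mul_eq_div]
    exact key
  · unfold sineFun
    exact (Complex.differentiable_sin.const_add 1).differentiableOn
  · intro r hr
    rw [Real.sinc_of_ne_zero hr.1.ne']
    exact div_pos (Real.sin_pos_of_pos_of_lt_pi hr.1 (by linarith [hr.2])) hr.1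
  · intro r hr
    have h := hmul r hr.1
    rw [← Complex.ofReal_mul, h, sineFun, Complex.sin_neg, Complex.ofReal_sin, sub_eq_add_neg]
  · intro w r h1 h2 h3 him
    have hwr := abs_le.1 ((Complex.abs_re_le_norm w).trans h1)
    rw [sineFun, Complex.add_im, Complex.one_im, zero_add, Complex.sin_eq] at him
    have him' : Real.cos w.re * Real.sinh w.im = 0 := by
      have h4 : (Complex.sin w).im = Real.cos w.re * Real.sinh w.im := by
        rw [Complex.sin_eq]
        simp [Complex.cos_ofReal_re, Complex.sinh_ofReal_re]
      rw [← h4, Complex.sin_eq]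
      exact him
    -- Im sin w = cos(Re w) sinh(Im w) with a positive cosine, so a real value of the sine forces w
    -- to be real.
    have hcos : 0 < Real.cos w.re := Real.cos_pos_of_mem_Ioo ⟨by linarith, by linarith⟩
    have hwi : w.im = 0 := Real.sinh_eq_zero.1 ((mul_eq_zero.1 him').resolve_left hcos.ne')
    have hw : w = (w.re : ℂ) := Complex.ext (by simp) (by simp [hwi])
    rw [hmul r h2, sineFun, hw, ← Complex.ofReal_sin, Complex.add_re, Complex.one_re,
      Complex.ofReal_re]
    have := Real.sin_le_sin_of_le_of_le_pi_div_two (x := -r) (y := w.re) (by linarith)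
      (by linarith) hwr.1
    rw [Real.sin_neg] at this
    linarith
  · intro w hw
    have h1 := Complex.norm_exp_sub_one_sub_id_le (x := w * Complex.I) (by simpa using hw.le)
    have h2 := Complex.norm_exp_sub_one_sub_id_le (x := -w * Complex.I) (by simpa using hw.le)
    -- sin w - w is half a difference of second-order exponential remainders, up to a factor i, and
    -- each remainder is at most |w|².
    have h3 : sineFun w - 1 = w + ((Complex.exp (-w * Complex.I) - 1 - -w * Complex.I)
        - (Complex.exp (w * Complex.I) - 1 - w * Complex.I)) * (Complex.I / 2) := by
      rw [sineFun, Complex.sin]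
      linear_combination (-w) * Complex.I_mul_I
    rw [h3]
    refine (norm_add_le _ _).trans (add_le_add_right ?_ _)
    rw [norm_mul, norm_div, Complex.norm_I, Complex.norm_ofNat]
    have h4 := norm_sub_le (Complex.exp (-w * Complex.I) - 1 - -w * Complex.I)
      (Complex.exp (w * Complex.I) - 1 - w * Complex.I)
    rw [norm_mul, Complex.norm_I, mul_one] at h1 h2
    rw [norm_neg] at h2
    linarith
  -- g(1) is a value sin c / c with 0 < c < 1, hence at least 5/6.
  · obtain ⟨c, hc, h1⟩ := exists_hasDerivAt_eq_slope
      (fun r => ∫ x in (0 : ℝ)..r, Real.sinc x) Real.sinc zero_lt_one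
      (fun r _ => (hderiv r).continuousAt.continuousWithinAt) (fun r _ => hderiv r)
    simp only [intervalIntegral.integral_same, sub_zero, div_one] at h1
    rw [← h1, Real.sinc_of_ne_zero hc.1.ne', le_div_iff₀ hc.1]
    have h2 := Real.sin_ge_sub_cube hc.1.le
    have h3 : c ^ 2 ≤ 1 := pow_le_one₀ hc.1.le hc.2.le
    have := hc.1
    nlinarith

theorem exp_isSharpBound :
    IsSharpBound Complex.exp ((1 / gammaConst)
      * ∑' n : ℕ+, (-1 : ℝ) ^ ((n : ℕ) + 1) / (((n : ℕ)! : ℝ) * ((n : ℕ) : ℝ))) := by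
  have hpi := Real.pi_gt_three
  set d : ℝ → ℝ := dslope (fun x => 1 - Real.exp (-x)) 0 with hd
  have hdc : Continuous d := by
    rw [← continuousOn_univ, hd, continuousOn_dslope Filter.univ_mem]
    exact ⟨by fun_prop, by fun_prop⟩
  have hmul : ∀ r : ℝ, r * d r = 1 - Real.exp (-r) := fun r => by
    simpa using sub_smul_dslope (fun x => 1 - Real.exp (-x)) 0 r
  have hderiv : ∀ r : ℝ, HasDerivAt (fun r => ∫ x in (0 : ℝ)..r, d x) (d r) r :=
    fun r => intervalIntegral.integral_hasDerivAt_right (hdc.intervalIntegrable _ _)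
      (hdc.stronglyMeasurableAtFilter _ _) hdc.continuousAt
  have hsum : HasSum (fun n : ℕ => (-1 : ℝ) ^ (n + 1 + 1)
      / (((n + 1)! : ℝ) * ((n + 1 : ℕ) : ℝ))) (∫ x in (0 : ℝ)..1, d x) := by
    have h := hasSum_integral_power (a := fun n => (-1 : ℝ) ^ n / ((n + 1)! : ℝ))
      (e := fun n => n) (F := d) ?_ ?_
    · convert h using 2 with n
      rw [pow_succ, pow_succ, div_div]
      push_cast
      ring
    · simp only [abs_div, abs_pow, abs_neg, abs_one, one_pow, Nat.abs_cast]
      exact summable_inv_factorial_comp (e := fun n => n + 1) fun a b hab => by simpa using hab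
    · intro x hx
      have h1 : HasSum (fun n : ℕ => (-x) ^ n / (n ! : ℝ)) (Real.exp (-x)) := by
        rw [Real.exp_eq_exp_ℝ]
        exact NormedSpace.expSeries_div_hasSum_exp (-x)
      rw [← hasSum_nat_add_iff' 1] at h1
      have h2 := (h1.neg).div_const x
      have h3 : d x = -(Real.exp (-x) - ∑ i ∈ Finset.range 1, (-x) ^ i / (i ! : ℝ)) / x := by
        rw [eq_div_iff hx.1.ne', mul_comm, hmul]
        simp
      rw [h3]
      refine hasSum_of_forall_eq h2 fun n => ?_
      have := hx.1.ne'
      rw [pow_succ, neg_pow x n]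
      field_simp
  have key := isSharpBound_of_norm_le_quadratic (h := Complex.exp)
    (g := fun r => ∫ x in (0 : ℝ)..r, d x) (d := d) Complex.differentiable_exp.differentiableOn
    Complex.exp_zero (fun r _ => hderiv r)
    (fun r _ => (hderiv r).continuousAt.continuousWithinAt) (by simp) ?_ ?_ ?_ ?_ ?_
  · rw [tsum_pnat_eq_tsum_succ
      (f := fun n : ℕ => (-1 : ℝ) ^ (n + 1) / ((n ! : ℝ) * (n : ℝ))), hsum.tsum_eq,
      one_div_mul_eq_div]
    exact key
  · intro r hr
    rw [← mul_pos_iff_of_pos_left hr.1, hmul]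
    linarith [Real.exp_lt_one_iff.2 (neg_lt_zero.2 hr.1)]
  · intro r _
    rw [← Complex.ofReal_mul, hmul]
    push_cast
    ring
  · intro w r h1 h2 h3 him
    have hwr := abs_le.1 ((Complex.abs_re_le_norm w).trans h1)
    have hwi := abs_le.1 ((Complex.abs_im_le_norm w).trans h1)
    rw [Complex.exp_im, mul_eq_zero, or_iff_right (Real.exp_pos _).ne',
      Real.sin_eq_zero_iff_of_lt_of_lt (by linarith) (by linarith)] at him
    rw [hmul, Complex.exp_re, him, Real.cos_zero, mul_one]
    linarith [Real.exp_le_exp.2 hwr.1]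
  · intro w hw
    have h1 := Complex.norm_exp_sub_one_sub_id_le hw.le
    calc ‖Complex.exp w - 1‖ = ‖w + (Complex.exp w - 1 - w)‖ := by ring_nf
      _ ≤ ‖w‖ + ‖Complex.exp w - 1 - w‖ := norm_add_le _ _
      _ ≤ ‖w‖ + ‖w‖ ^ 2 := by linarith
  -- Comparison with r - r²/4, the primitive of the lower bound 1 - r/2 for (1 - e^(-r))/r, gives
  -- g(1) ≥ 3/4.
  · obtain ⟨c, hc, h1⟩ := exists_hasDerivAt_eq_slope
      (fun r => (∫ x in (0 : ℝ)..r, d x) - (r - r ^ 2 / 4)) (fun r => d r - (1 - r / 2))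
      zero_lt_one
      (fun r _ => ContinuousWithinAt.sub (hderiv r).continuousAt.continuousWithinAt
        (by fun_prop))
      (fun r _ => (hderiv r).sub (((hasDerivAt_id' r).sub
        (((hasDerivAt_id' r).pow 2).div_const 4)).congr_deriv (by norm_num; ring)))
    have h2 : 0 ≤ d c - (1 - c / 2) := by
      refine nonneg_of_mul_nonneg_right ?_ hc.1
      rw [mul_sub, hmul]
      linarith [exp_neg_le_quadratic hc.1.le]
    norm_num at h1 ⊢
    linarith

end CardioidSubordination

end

theorem mainTheorem12 (α A B : ℝ) (hα0 : 0 < α) (hα1 : α < 1)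
    (hB : 0 < B) (hBA : B < A) (hA : A < 1) :
    CardioidSubordination.IsSharpBound CardioidSubordination.phiZero
      ((-1 + 2 * CardioidSubordination.kConst
          * Real.log (1 + 1 / CardioidSubordination.kConst))
        / (CardioidSubordination.gammaConst * CardioidSubordination.kConst)) ∧
    CardioidSubordination.IsSharpBound CardioidSubordination.lemniscate
      (2 * (1 - Real.log 2) / CardioidSubordination.gammaConst) ∧
    CardioidSubordination.IsSharpBound (CardioidSubordination.phiAlpha α)
      (Real.log ((1 + √α) / (1 - √α)) / (2 * CardioidSubordination.gammaConst * √α)) ∧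
    CardioidSubordination.IsSharpBound (CardioidSubordination.janowski A B)
      (max ((A - B) * Real.log (1 / (1 - B)) / (CardioidSubordination.gammaConst * B))
        ((A - B) * Real.log (1 + B) / (B * Real.log (1 + Real.exp 1)))) ∧
    CardioidSubordination.IsSharpBound CardioidSubordination.sineFun
      ((1 / CardioidSubordination.gammaConst)
        * ∑' n : ℕ, (-1 : ℝ) ^ (3 * n + 2) / (((2 * n + 1)! : ℝ) * (2 * (n : ℝ) + 1))) ∧
    CardioidSubordination.IsSharpBound CardioidSubordination.crescent
      ((3 - CardioidSubordination.kConst + Real.log (CardioidSubordination.kConst / 2))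
        / CardioidSubordination.gammaConst) ∧
    CardioidSubordination.IsSharpBound Complex.exp
      ((1 / CardioidSubordination.gammaConst)
        * ∑' n : ℕ+, (-1 : ℝ) ^ ((n : ℕ) + 1) / (((n : ℕ)! : ℝ) * ((n : ℕ) : ℝ))) := by
  refine ⟨CardioidSubordination.phiZero_isSharpBound,
    CardioidSubordination.lemniscate_isSharpBound,
    CardioidSubordination.phiAlpha_isSharpBound hα0 hα1, ?_,
    CardioidSubordination.sineFun_isSharpBound,
    CardioidSubordination.crescent_isSharpBound, CardioidSubordination.exp_isSharpBound⟩
  rw [CardioidSubordination.janowski_max_eq hB hBA hA]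
  exact CardioidSubordination.janowski_isSharpBound hB hBA hA
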